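/- **Setting.** Let $\mathcal X$ be a measurable space of arms and let $M$ assign to each arm $x$ a probability distribution $M_x$ on $[0,1]$, with measurable mean-payoff function $f(x)=\int y\,dM_x(y)$; put $f^*=\sup_x f(x)$ and $\mathcal X_\varepsilon=\{x: f(x)\ge f^*-\varepsilon\}$. Playing an arm $x$ yields a reward drawn from $M_x$, independently of the past given $x$. A tree of coverings is a family of measurable sets $\mathcal P_{h,i}\subset\mathcal X$ ($h\ge 0$, $1\le i\le 2^h$) with $\mathcal P_{0,1}=\mathcal X$ and $\mathcal P_{h,i}=\mathcal P_{h+1,2i-1}\cup\mathcal P_{h+1,2i}$; the children of the node $(h,i)$ are $(h+1,2i-1)$ and $(h+1,2i)$. **Assumptions.** Let $\nu_1,\nu_2>0$, $\rho\in(0,1)$, and let $\ell\ge 0$ be a dissimilarity on $\mathcal X$ (that is, $\ell(x,x)=0$ for all $x$), with open balls $\mathcal B(x,\varepsilon)=\{y:\ell(x,y)<\varepsilon\}$. Assume that * (A1) for all $h\ge0$: $\sup_{x,y\in\mathcal P_{h,i}}\ell(x,y)\le\nu_1\rho^h$ for all $1\le i\le 2^h$, and there are points $x_{h,i}\in\mathcal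 P_{h,i}$ such that the balls $\mathcal B(x_{h,i},\nu_2\rho^h)$, $1\le i\le 2^h$, are pairwise disjoint and $\mathcal B(x_{h,i},\nu_2\rho^h)\subset\mathcal P_{h,i}$; * (A2) $f^*-f(y)\le f^*-f(x)+\max\{f^*-f(x),\ell(x,y)\}$ for all $x,y\in\mathcal X$. Let $d=\max\bigl\{0,\limsup_{\varepsilon\to0}\ln\mathcal N(\mathcal X_{c\varepsilon},\ell,\varepsilon)/\ln(\varepsilon^{-1})\bigr\}\in[0,+\infty]$ with $c=4\nu_1/\nu_2$, where $\mathcal N(A,\ell,\varepsilon)$ is the largest number of pairwise disjoint $\ell$-open balls of radius $\varepsilon$ contained in $A$. **Algorithm.** For a horizon $n_0\ge 1$ let $D_{n_0}=\Bigl\lceil\frac{(\ln n_0)/2-\ln(1/\nu_1)}{\ln(1/\rho)}\Bigr\rceil$. Truncated HOO plays a node $(H_t,I_t)$ in each round $t=1,\dots,n_0$: it chooses an arm $X_t\in\mathcal P_{H_t,I_t}$, in an arbitrary way that may use the past and extra randomness but not future rewards, and receives the reward $Y_t$. Let $\mathcal T_n$ consist of the root $(0,1)$ and the nodes played in rounds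 $1,\dots,n$; let $T_{h,i}(n)$ be the number of rounds $t\le n$ in which a descendant of $(h,i)$ was played (every node being a descendant of itself) and $\widehat\mu_{h,i}(n)$ the average reward of these rounds. Put $U_{h,i}(n)=\widehat\mu_{h,i}(n)+\sqrt{2\ln n_0/T_{h,i}(n)}+\nu_1\rho^h$ if $T_{h,i}(n)>0$ and $U_{h,i}(n)=+\infty$ otherwise. For $h\le D_{n_0}$ put $B_{h,i}(n)=+\infty$ if $(h,i)\notin\mathcal T_n$; otherwise $B_{h,i}(n)=U_{h,i}(n)$ if $h=D_{n_0}$, and $B_{h,i}(n)=\min\{U_{h,i}(n),\max\{B_{h+1,2i-1}(n),B_{h+1,2i}(n)\}\}$ if $h<D_{n_0}$. In round $t$ the algorithm starts at the root, moves repeatedly to a child with the largest value $B(t-1)$ (ties broken in any way), and plays the first node that is not in $\mathcal T_{t-1}$ or has depth $D_{n_0}$. **Theorem (upper bound on the regret of truncated HOO).** Under these assumptions: 1. For every real $d'>d$ there is a constant $\gamma$, not depending on $n_0$, such that for every $n_0\ge1$ with $D_{n_0}\ge1$, truncated HOO run with horizon $n_0$ satisfies $$\mathbb E[R_{n_0}]\le\gamma\,n_0^{(d'+1)/(d'+2)}(\ln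 n_0)^{1/(d'+2)}+4\sqrt{n_0},\qquad R_{n_0}=n_0f^*-\sum_{t=1}^{n_0}f(X_t).$$ 2. Truncated HOO runs in time $O(n_0\ln n_0)$. Precisely, consider the program that stores the tree with the counters, empirical means and $B$-values of its nodes, and after each round recomputes these only along the path followed. For every $n_0\ge 1$ with $D_{n_0}\ge1$ and every reward sequence, the node sequences it can play, over all ways of breaking ties, are exactly those of truncated HOO. There is a constant $C$, depending only on $\nu_1$ and $\rho$, such that for every $n_0\ge2$ with $D_{n_0}\ge1$, all rewards and all ways of breaking ties, it uses at most $C\,n_0\ln n_0$ elementary operations (real and integer arithmetic, comparisons, evaluations of $\ln$, square root, rounding up, memory accesses, tie-breaking bits, and plays of an arm, each at unit cost). -/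

import Mathlib

open MeasureTheory Filter Topology

namespace HOO

/-! ### Bandit environments -/

/-- A bandit environment on the measurable space `𝒳` of arms: to each arm a probability
distribution on `ℝ` carried by `[0, 1]`, with a measurable mean-payoff function. -/
structure BanditEnv (𝒳 : Type*) [MeasurableSpace 𝒳] where
  /-- the distribution of the rewards of each arm -/
  law : 𝒳 → ProbabilityMeasure ℝ
  law_unit : ∀ x, (law x : Measure ℝ) (Set.Icc (0 : ℝ) 1)ᶜ = 0
  measurable_mean : Measurable fun x => ∫ y, y ∂(law x : Measure ℝ)

/-- The mean-payoff function `f(x) = ∫ y dM_x(y)`. -/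
noncomputable def BanditEnv.mean {𝒳 : Type*} [MeasurableSpace 𝒳] (M : BanditEnv 𝒳) (x : 𝒳) : ℝ :=
  ∫ y, y ∂(M.law x : Measure ℝ)

/-- The best mean payoff `f^* = sup_x f(x)`. -/
noncomputable def best {𝒳 : Type*} (f : 𝒳 → ℝ) : ℝ := ⨆ x, f x

/-- The set of `ε`-optimal arms. -/
def nearOptimal {𝒳 : Type*} (f : 𝒳 → ℝ) (ε : ℝ) : Set 𝒳 := {x | best f - ε ≤ f x}

/-! ### Nodes of the infinite binary tree, trees of coverings -/

/-- A node `(h, i)`: depth `h` and index `i`, where `1 ≤ i ≤ 2 ^ h` for the nodes of the tree. -/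
abbrev Node : Type := ℕ × ℕ

/-- The root `(0, 1)`. -/
def root : Node := (0, 1)

/-- The first child `(h + 1, 2 i - 1)`. -/
def child₁ (v : Node) : Node := (v.1 + 1, 2 * v.2 - 1)

/-- The second child `(h + 1, 2 i)`. -/
def child₂ (v : Node) : Node := (v.1 + 1, 2 * v.2)

/-- `IsDescendant v w`: the node `w` is a descendant of `v` (each node is its own descendant). -/
def IsDescendant (v w : Node) : Prop :=
  Relation.ReflTransGen (fun a b => b = child₁ a ∨ b = child₂ a) v w

/-- `P h i` is the region of the node `(h, i)`; values outside `1 ≤ i ≤ 2 ^ h` are irrelevant. -/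
structure IsTreeOfCoverings {𝒳 : Type*} [MeasurableSpace 𝒳] (P : ℕ → ℕ → Set 𝒳) : Prop where
  measurableSet : ∀ h i, 1 ≤ i → i ≤ 2 ^ h → MeasurableSet (P h i)
  root_eq : P 0 1 = Set.univ
  union_eq : ∀ h i, 1 ≤ i → i ≤ 2 ^ h → P h i = P (h + 1) (2 * i - 1) ∪ P (h + 1) (2 * i)

/-! ### Dissimilarities and the two assumptions -/

/-- A dissimilarity: nonnegative and zero on the diagonal (not necessarily symmetric). -/
structure IsDissimilarity {𝒳 : Type*} (ℓ : 𝒳 → 𝒳 → ℝ) : Prop where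
  nonneg : ∀ x y, 0 ≤ ℓ x y
  self : ∀ x, ℓ x x = 0

/-- The diameter `sup_{x, y ∈ A} ℓ(x, y)`, in the extended reals. -/
noncomputable def diam {𝒳 : Type*} (ℓ : 𝒳 → 𝒳 → ℝ) (A : Set 𝒳) : EReal :=
  ⨆ x ∈ A, ⨆ y ∈ A, (ℓ x y : EReal)

/-- The `ℓ`-open ball `{y | ℓ(x, y) < ε}`. -/
def ball {𝒳 : Type*} (ℓ : 𝒳 → 𝒳 → ℝ) (x : 𝒳) (ε : ℝ) : Set 𝒳 := {y | ℓ x y < ε}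

/-- First assumption: the regions shrink at the geometric rate `ρ ^ h`. -/
structure Shrinking {𝒳 : Type*} (P : ℕ → ℕ → Set 𝒳) (ℓ : 𝒳 → 𝒳 → ℝ) (ν₁ ρ ν₂ : ℝ) : Prop where
  diam_le : ∀ h i, 1 ≤ i → i ≤ 2 ^ h → diam ℓ (P h i) ≤ ((ν₁ * ρ ^ h : ℝ) : EReal)
  exists_balls : ∀ h, ∃ c : ℕ → 𝒳,
    (∀ i, 1 ≤ i → i ≤ 2 ^ h → c i ∈ P h i ∧ ball ℓ (c i) (ν₂ * ρ ^ h) ⊆ P h i) ∧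
    ∀ i j, 1 ≤ i → i < j → j ≤ 2 ^ h →
      Disjoint (ball ℓ (c i) (ν₂ * ρ ^ h)) (ball ℓ (c j) (ν₂ * ρ ^ h))

/-- Second assumption: `f` is weakly Lipschitz with respect to `ℓ`. -/
def WeaklyLipschitz {𝒳 : Type*} (ℓ : 𝒳 → 𝒳 → ℝ) (f : 𝒳 → ℝ) : Prop :=
  ∀ x y, best f - f y ≤ best f - f x + max (best f - f x) (ℓ x y)

/-! ### Near-optimality dimension -/

/-- The `ε`-packing number of `A`: the largest number (possibly `⊤`) of pairwise disjoint
`ℓ`-open balls of radius `ε` contained in `A`; `s` is the set of their centers. -/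
noncomputable def packingNumber {𝒳 : Type*} (A : Set 𝒳) (ℓ : 𝒳 → 𝒳 → ℝ) (ε : ℝ) : ℕ∞ :=
  ⨆ (s : Finset 𝒳) (_ : (∀ x ∈ s, ball ℓ x ε ⊆ A) ∧
    (s : Set 𝒳).PairwiseDisjoint fun x => ball ℓ x ε), (s.card : ℕ∞)

/-- The `c`-near-optimality dimension of `f` with respect to `ℓ`, in `[0, +∞]`. -/
noncomputable def nearOptDim {𝒳 : Type*} (f : 𝒳 → ℝ) (ℓ : 𝒳 → 𝒳 → ℝ) (c : ℝ) : EReal :=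
  max 0 (limsup (fun ε : ℝ =>
    ENNReal.log (packingNumber (nearOptimal f (c * ε)) ℓ ε : ENNReal) / (Real.log ε⁻¹ : EReal))
    (𝓝[>] 0))

/-! ### The truncated HOO algorithm

`N t` is the node played in round `t ≥ 1` and `y t` the reward received in that round. -/

/-- The truncation depth `⌈((ln n₀) / 2 - ln (1 / ν₁)) / ln (1 / ρ)⌉` (`0` if this is negative). -/
noncomputable def truncDepth (ν₁ ρ : ℝ) (n₀ : ℕ) : ℕ :=
  ⌈(Real.log n₀ / 2 - Real.log (1 / ν₁)) / Real.log (1 / ρ)⌉₊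

open Classical in
/-- The rounds `1 ≤ t ≤ n` in which a descendant of `v` was played. -/
noncomputable def visits (N : ℕ → Node) (v : Node) (n : ℕ) : Finset ℕ :=
  {t ∈ Finset.Icc 1 n | IsDescendant v (N t)}

/-- The counter `T_{h,i}(n)`. -/
noncomputable def count (N : ℕ → Node) (v : Node) (n : ℕ) : ℕ := (visits N v n).card

/-- The empirical average of the rewards received in the descendants of `v`. -/
noncomputable def empMean (N : ℕ → Node) (y : ℕ → ℝ) (v : Node) (n : ℕ) : ℝ :=
  1 / (count N v n : ℝ) * ∑ t ∈ visits N v n, y t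

/-- The `U`-value at the end of round `n`, with `ln n₀` in place of `ln n`. -/
noncomputable def UValue (ν₁ ρ : ℝ) (n₀ : ℕ) (N : ℕ → Node) (y : ℕ → ℝ) (n : ℕ) (v : Node) :
    EReal :=
  if 0 < count N v n then
    ((empMean N y v n + Real.sqrt (2 * Real.log n₀ / (count N v n : ℝ)) + ν₁ * ρ ^ v.1 : ℝ) : EReal)
  else ⊤

/-- The tree stored at the end of round `n`: the root and the nodes played so far. -/
def tree (N : ℕ → Node) (n : ℕ) : Set Node := {v | v = root ∨ ∃ t, 1 ≤ t ∧ t ≤ n ∧ N t = v}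

open Classical in
/-- The backward recursion for the `B`-values; `k` is the number of levels between the node
and the truncation depth. -/
noncomputable def BAux (ν₁ ρ : ℝ) (n₀ : ℕ) (N : ℕ → Node) (y : ℕ → ℝ) (n : ℕ) :
    ℕ → Node → EReal
  | 0, v => if v ∈ tree N n then UValue ν₁ ρ n₀ N y n v else ⊤
  | k + 1, v =>
    if v ∈ tree N n then
      min (UValue ν₁ ρ n₀ N y n v)
        (max (BAux ν₁ ρ n₀ N y n k (child₁ v)) (BAux ν₁ ρ n₀ N y n k (child₂ v)))
    else ⊤

/-- The `B`-value of a node (of depth at most the truncation depth) at the end of round `n`. -/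
noncomputable def BValue (ν₁ ρ : ℝ) (n₀ : ℕ) (N : ℕ → Node) (y : ℕ → ℝ) (n : ℕ) (v : Node) :
    EReal :=
  BAux ν₁ ρ n₀ N y n (truncDepth ν₁ ρ n₀ - v.1) v

/-- One step of the tree traversal with the values of the end of round `n`: from a node of the
tree above the truncation depth to a child of highest `B`-value, ties being broken in any way. -/
def GreedyStep (ν₁ ρ : ℝ) (n₀ : ℕ) (N : ℕ → Node) (y : ℕ → ℝ) (n : ℕ) (v w : Node) : Prop :=
  v ∈ tree N n ∧ v.1 < truncDepth ν₁ ρ n₀ ∧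
    ((w = child₁ v ∧
        BValue ν₁ ρ n₀ N y n (child₂ v) ≤ BValue ν₁ ρ n₀ N y n (child₁ v)) ∨
      (w = child₂ v ∧
        BValue ν₁ ρ n₀ N y n (child₁ v) ≤ BValue ν₁ ρ n₀ N y n (child₂ v)))

/-- The node `w` can be selected in round `n + 1`: a traversal started at the root stops there,
because `w` is not yet in the tree or has the truncation depth. -/
def Selectable (ν₁ ρ : ℝ) (n₀ : ℕ) (N : ℕ → Node) (y : ℕ → ℝ) (n : ℕ) (w : Node) : Prop :=
  Relation.ReflTransGen (GreedyStep ν₁ ρ n₀ N y n) root w ∧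
    (w ∉ tree N n ∨ w.1 = truncDepth ν₁ ρ n₀)

/-- With rewards `y`, truncated HOO can play the nodes `N 1, …, N n₀` in rounds `1, …, n₀`. -/
def IsTruncatedHOO (ν₁ ρ : ℝ) (n₀ : ℕ) (N : ℕ → Node) (y : ℕ → ℝ) : Prop :=
  ∀ t, 1 ≤ t → t ≤ n₀ → Selectable ν₁ ρ n₀ N y (t - 1) (N t)

/-! ### The random interaction with the environment -/

/-- The information available when the reward of round `t` is drawn: nodes and arms of the
rounds `1, …, t` and rewards of the rounds `1, …, t - 1`. -/
@[reducible] def history {Ω 𝒳 : Type*} [MeasurableSpace 𝒳] (N : ℕ → Ω → Node) (X : ℕ → Ω → 𝒳)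
    (Y : ℕ → Ω → ℝ) (t : ℕ) : MeasurableSpace Ω :=
  (⨆ s ∈ Finset.Icc 1 t,
      (MeasurableSpace.comap (N s) inferInstance ⊔ MeasurableSpace.comap (X s) inferInstance)) ⊔
    ⨆ s ∈ Finset.Ico 1 t, MeasurableSpace.comap (Y s) inferInstance

/-- On the probability space `(Ω, μ)`, the nodes `N t`, arms `X t` and rewards `Y t` come from
playing truncated HOO for the horizon `n₀` against the environment `M`. Ties and arms in the
selected regions are chosen arbitrarily (possibly at random, possibly using the past). -/
structure IsTruncatedHOORun {Ω 𝒳 : Type*} [MeasurableSpace Ω] [MeasurableSpace 𝒳]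
    (M : BanditEnv 𝒳) (P : ℕ → ℕ → Set 𝒳) (ν₁ ρ : ℝ) (n₀ : ℕ) (μ : Measure Ω)
    (N : ℕ → Ω → Node) (X : ℕ → Ω → 𝒳) (Y : ℕ → Ω → ℝ) : Prop where
  measurable_node : ∀ t, 1 ≤ t → t ≤ n₀ → Measurable (N t)
  measurable_arm : ∀ t, 1 ≤ t → t ≤ n₀ → Measurable (X t)
  measurable_reward : ∀ t, 1 ≤ t → t ≤ n₀ → Measurable (Y t)
  node_selected : ∀ᵐ ω ∂μ, IsTruncatedHOO ν₁ ρ n₀ (fun t => N t ω) (fun t => Y t ω)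
  arm_mem : ∀ t, 1 ≤ t → t ≤ n₀ → ∀ᵐ ω ∂μ, X t ω ∈ P (N t ω).1 (N t ω).2
  /-- given the history, the reward is drawn from the distribution of the arm played -/
  reward_law : ∀ t, 1 ≤ t → t ≤ n₀ → ∀ S : Set ℝ, MeasurableSet S →
    μ[(Y t ⁻¹' S).indicator (fun _ => (1 : ℝ)) | history N X Y t]
      =ᵐ[μ] fun ω => (M.law (X t ω) : Measure ℝ).real S

/-- The cumulative pseudo-regret `n f^* - ∑_{t = 1}^n f(X_t)`. -/
noncomputable def pseudoRegret {Ω 𝒳 : Type*} (f : 𝒳 → ℝ) (X : ℕ → Ω → 𝒳) (n : ℕ) (ω : Ω) : ℝ :=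
  n * best f - ∑ t ∈ Finset.Icc 1 n, f (X t ω)

/-! ### A step-counting implementation

The cost model is that of a unit-cost machine with real numbers. Every arithmetic operation,
comparison, evaluation of `ln`, `√`, `⌈·⌉`, `min`, `max`, inspection of a case or of a stored
value, creation of a tree or list cell and interaction with the outside (a tie-breaking bit
received, an arm of the selected region played and its reward received) is one elementary
operation, written `step`, and costs one unit of time. Only `B`-values of nodes on the current path are recomputed. -/

/-- A result together with the number of elementary operations spent on it. -/
structure Timed (α : Type) where
  /-- the result -/
  val : α
  /-- the number of elementary operations -/
  time : ℕ

instance : Monad Timed where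
  pure a := ⟨a, 0⟩
  bind x g := ⟨(g x.val).val, x.time + (g x.val).time⟩

/-- One elementary operation with result `a`. -/
def step {α : Type} (a : α) : Timed α := ⟨a, 1⟩

/-- The data structure: a binary tree storing at each node the counter, the empirical mean and
the `B`-value; `nil` stands for a node that has not been played. -/
inductive HTree : Type
  | nil : HTree
  | node (T : ℕ) (mean : ℝ) (B : EReal) (left right : HTree) : HTree

/-- The stored `B`-value, `+∞` for a node that has not been played. -/
noncomputable def HTree.storedB : HTree → EReal
  | .nil => ⊤
  | .node _ _ B _ _ => B

/-- Tree traversal from the node `v`, the root of the given subtree, with at most `k` further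
levels to go. Returns the selected node and the turns taken (`true` for the first child). The bit
`tie u` is used to break a tie between the children of `u`. -/
noncomputable def select (tie : Node → Bool) : ℕ → Node → HTree → Timed (Node × List Bool)
  | 0, v, _ => step (v, [])
  | _ + 1, v, .nil => step (v, [])
  | k + 1, v, .node _ _ _ l r => do
    let b₁ ← step l.storedB
    let b₂ ← step r.storedB
    let gt ← step (decide (b₂ < b₁))
    let lt ← step (decide (b₁ < b₂))
    let z ← step (tie v)
    let turn ← step (gt || (!lt && z))
    let h ← step (v.1 + 1)
    let i ← step (2 * v.2)
    if turn then
      let j ← step (i - 1)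
      let res ← select tie k (h, j) l
      step (res.1, true :: res.2)
    else
      let res ← select tie k (h, i) r
      step (res.1, false :: res.2)

/-- Update of the statistics of a node on the path after the reward `y`; `c` is `2 ln n₀` and
`w` is `ν₁ ρ ^ h`. -/
noncomputable def refresh (c w y : ℝ) (T : ℕ) (m : ℝ) (l r : HTree) : Timed HTree := do
  let T' ← step (T + 1)
  let a ← step (1 / (T' : ℝ))
  let b ← step (1 - a)
  let m₁ ← step (b * m)
  let m₂ ← step (y / (T' : ℝ))
  let m' ← step (m₁ + m₂)
  let e ← step (c / (T' : ℝ))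
  let s ← step (Real.sqrt e)
  let u₁ ← step (m' + s)
  let u ← step (u₁ + w)
  let b₁ ← step l.storedB
  let b₂ ← step r.storedB
  let b₃ ← step (max b₁ b₂)
  let B ← step (min (u : EReal) b₃)
  step (HTree.node T' m' B l r)

/-- Update along the path given by the list of turns, from its end back to its start. -/
noncomputable def update (ρ c y : ℝ) : List Bool → ℝ → HTree → Timed HTree
  | [], w, .nil => do
    let t ← step HTree.nil
    refresh c w y 0 0 t t
  | [], w, .node T m _ l r => do
    let t ← step r
    refresh c w y T m l t
  | _ :: _, _, .nil => step HTree.nil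
  | turn :: p, w, .node T m _ l r => do
    let goLeft ← step turn
    let w' ← step (w * ρ)
    if goLeft then
      let l' ← update ρ c y p w' l
      refresh c w y T m l' r
    else
      let r' ← update ρ c y p w' r
      refresh c w y T m l r'

/-- The first rounds of the algorithm with truncation depth `D`. Returns the stored tree and the
list of the nodes played, the last one first. -/
noncomputable def rounds (D : ℕ) (ν₁ ρ c : ℝ) (tie : ℕ → Node → Bool) (y : ℕ → ℝ) :
    ℕ → Timed (HTree × List Node)
  | 0 => step (HTree.node 0 0 ⊤ HTree.nil HTree.nil, [])
  | n + 1 => do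
    let st ← rounds D ν₁ ρ c tie y n
    let t ← step (n + 1)
    let sel ← select (tie t) D root st.1
    let played ← step (sel.1 :: st.2)
    let reward ← step (y t)
    let tr ← update ρ c reward sel.2 ν₁ st.1
    step (tr, played)

/-- The complete program, for the horizon `n₀`; `tie` are the tie-breaking bits and `y t` is the
reward answered by the environment in round `t`. Returns the nodes played, the last one first. -/
noncomputable def program (ν₁ ρ : ℝ) (n₀ : ℕ) (tie : ℕ → Node → Bool) (y : ℕ → ℝ) :
    Timed (List Node) := do
  let L ← step (Real.log n₀)
  let a ← step (L / 2)
  let q ← step (1 / ν₁)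
  let b ← step (Real.log q)
  let num ← step (a - b)
  let r ← step (1 / ρ)
  let den ← step (Real.log r)
  let x ← step (num / den)
  let D ← step ⌈x⌉₊
  let c ← step (2 * L)
  let res ← rounds D ν₁ ρ c tie y n₀
  step res.2

end HOO

namespace HOO

/-! ### The binary tree of nodes -/

/-! The regret bound rests on optimism. Some infinite path from the root runs through regions
containing arms of payoff arbitrarily close to `best f` (`exists_optimal_path`). While the
confidence bounds hold, the `U`-values on this path are at least `best f` (`best_le_UValue`), hence
so is the `B`-value of the root, and `B` cannot decrease along the greedy descent
(`le_BValue_of_greedy`). So a node of the tree with `U`-value below `best f` is never traversed. In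
a node of depth `h` that is not near-optimal, every arm has gap above `2ν₁ρ^h`, and once it has `8
ln n₀ / (ν₁ρ^h)²` visits its `U`-value is below `best f` (`UValue_lt_best`,
`count_le_of_confidence`). The confidence bounds of one node fail with probability at most `2 /
n₀²`, by an exponential supermartingale and a union bound (`measureReal_deviationEvent_le`).

The regret is charged relative to any depth `H` up to the truncation depth `D`. A played node lies
below a near-optimal node of depth `H`, or is near-optimal of depth below `H` and played only once,
or lies below a suboptimal child of a near-optimal node (`sum_gap_le`). Near-optimal nodes of depth
`h` contain disjoint balls of radius `ν₂ρ^h` inside a near-optimal set, so there are `O(ρ^(-d'h))`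
of them (`exists_card_nearIndices_le`). Up to constants this gives `n₀ρ^H + (ln n₀)ρ^(-(d'+1)H)`,
which `exists_balanced_depth` balances. If the balanced depth exceeds `D`, taking `H = D` costs the
additional `4√n₀`.

For the program, a play changes the statistics only at ancestors of the node played, so
recomputation along the path keeps the stored tree equal to the one defined by the recursion
(`update_stored`). Each level costs a bounded number of operations, and `D = O(ln n₀)`. -/

lemma isDescendant_child₁ (v : Node) : IsDescendant v (child₁ v) :=
  Relation.ReflTransGen.single (Or.inl rfl)

lemma isDescendant_child₂ (v : Node) : IsDescendant v (child₂ v) :=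
  Relation.ReflTransGen.single (Or.inr rfl)

lemma IsDescendant.refl (v : Node) : IsDescendant v v := Relation.ReflTransGen.refl

lemma IsDescendant.trans {u v w : Node} (h : IsDescendant u v) (h' : IsDescendant v w) :
    IsDescendant u w := Relation.ReflTransGen.trans h h'

/-- The indices `k` levels below index `i` fill the interval `((i - 1)2^k, i 2^k]`; the lower end is
written additively to avoid truncated subtraction. -/
lemma IsDescendant.bounds {v w : Node} (h : IsDescendant v w) (_hv : 1 ≤ v.2) :
    ∃ k, w.1 = v.1 + k ∧ 2 ^ k * v.2 < w.2 + 2 ^ k ∧ w.2 ≤ 2 ^ k * v.2 := by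
  induction h with
  | refl => exact ⟨0, by simp⟩
  | tail _ hbc ih =>
    obtain ⟨k, h1, h2, h3⟩ := ih
    refine ⟨k + 1, ?_⟩
    have e1 : 2 ^ (k + 1) * v.2 = 2 * (2 ^ k * v.2) := by ring
    have e2 : 2 ^ (k + 1) = 2 * 2 ^ k := by ring
    rw [e1, e2]
    rcases hbc with rfl | rfl <;> simp only [child₁, child₂] <;> omega

lemma IsDescendant.one_le {v w : Node} (h : IsDescendant v w) (hv : 1 ≤ v.2) : 1 ≤ w.2 := by
  induction h with
  | refl => exact hv
  | tail _ hbc ih => rcases hbc with rfl | rfl <;> simp only [child₁, child₂] <;> omega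

lemma IsDescendant.depth_le {v w : Node} (h : IsDescendant v w) : v.1 ≤ w.1 := by
  induction h with
  | refl => exact le_rfl
  | tail _ hbc ih => rcases hbc with rfl | rfl <;> simp only [child₁, child₂] <;> omega

lemma IsDescendant.eq_or {v w : Node} (h : IsDescendant v w) :
    v = w ∨ IsDescendant (child₁ v) w ∨ IsDescendant (child₂ v) w := by
  rcases Relation.ReflTransGen.cases_head h with h | ⟨c, rfl | rfl, h⟩
  · exact Or.inl h
  · exact Or.inr (Or.inl h)
  · exact Or.inr (Or.inr h)

/-- At each depth the index intervals of two siblings are disjoint. Hence the ancestors of a node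
form a single path. -/
lemma not_isDescendant_both {v w : Node} (hv : 1 ≤ v.2) (h₁ : IsDescendant (child₁ v) w)
    (h₂ : IsDescendant (child₂ v) w) : False := by
  obtain ⟨k, a1, a2, a3⟩ := h₁.bounds (by simp only [child₁]; omega)
  obtain ⟨l, b1, b2, b3⟩ := h₂.bounds (by simp only [child₂]; omega)
  simp only [child₁, child₂] at *
  obtain rfl : k = l := by omega
  have : 2 ^ k * (2 * v.2) = 2 ^ k * (2 * v.2 - 1) + 2 ^ k := by
    rw [← Nat.mul_succ]; congr 1; omega
  omega

lemma IsDescendant.eq_of_depth_le {v w : Node} (h : IsDescendant v w) (hd : w.1 ≤ v.1) : v = w := by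
  rcases h.eq_or with h | h | h
  · exact h
  · have := h.depth_le; simp only [child₁] at this; omega
  · have := h.depth_le; simp only [child₂] at this; omega

/-! ### Recursion for the statistics -/

lemma root_mem_tree (N : ℕ → Node) (n : ℕ) : root ∈ tree N n := Or.inl rfl

lemma mem_tree_succ (N : ℕ → Node) (n : ℕ) (v : Node) :
    v ∈ tree N (n + 1) ↔ v ∈ tree N n ∨ N (n + 1) = v := by
  simp only [tree, Set.mem_ofPred_eq]
  constructor
  · rintro (h | ⟨t, h1, h2, h3⟩)
    · exact Or.inl (Or.inl h)
    · rcases Nat.lt_or_ge n t with h | h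
      · obtain rfl : t = n + 1 := by omega
        exact Or.inr h3
      · exact Or.inl (Or.inr ⟨t, h1, h, h3⟩)
  · rintro ((h | ⟨t, h1, h2, h3⟩) | h)
    · exact Or.inl h
    · exact Or.inr ⟨t, h1, by omega, h3⟩
    · exact Or.inr ⟨n + 1, by omega, le_rfl, h⟩

lemma mem_visits {N : ℕ → Node} {v : Node} {n t : ℕ} :
    t ∈ visits N v n ↔ (1 ≤ t ∧ t ≤ n) ∧ IsDescendant v (N t) := by
  simp [visits]

lemma visits_zero (N : ℕ → Node) (v : Node) : visits N v 0 = ∅ := by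
  simp [visits]

lemma visits_succ_of_isDescendant {N : ℕ → Node} {v : Node} {n : ℕ}
    (h : IsDescendant v (N (n + 1))) : visits N v (n + 1) = insert (n + 1) (visits N v n) := by
  ext t
  simp only [Finset.mem_insert, mem_visits]
  constructor
  · rintro ⟨⟨h1, h2⟩, h3⟩
    rcases Nat.lt_or_ge n t with h | h
    · left; omega
    · exact Or.inr ⟨⟨h1, h⟩, h3⟩
  · rintro (rfl | ⟨⟨h1, h2⟩, h3⟩)
    · exact ⟨⟨by omega, le_rfl⟩, h⟩
    · exact ⟨⟨h1, by omega⟩, h3⟩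

lemma visits_succ_of_not {N : ℕ → Node} {v : Node} {n : ℕ}
    (h : ¬ IsDescendant v (N (n + 1))) : visits N v (n + 1) = visits N v n := by
  ext t
  simp only [mem_visits]
  constructor
  · rintro ⟨⟨h1, h2⟩, h3⟩
    rcases Nat.lt_or_ge n t with h' | h'
    · obtain rfl : t = n + 1 := by omega
      exact absurd h3 h
    · exact ⟨⟨h1, h'⟩, h3⟩
  · rintro ⟨⟨h1, h2⟩, h3⟩
    exact ⟨⟨h1, by omega⟩, h3⟩

lemma succ_notMem_visits (N : ℕ → Node) (v : Node) (n : ℕ) : n + 1 ∉ visits N v n := by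
  simp [mem_visits]

lemma count_succ_of_isDescendant {N : ℕ → Node} {v : Node} {n : ℕ}
    (h : IsDescendant v (N (n + 1))) : count N v (n + 1) = count N v n + 1 := by
  simp [count, visits_succ_of_isDescendant h, succ_notMem_visits]

lemma empMean_succ_of_isDescendant {N : ℕ → Node} (y : ℕ → ℝ) {v : Node} {n : ℕ}
    (h : IsDescendant v (N (n + 1))) :
    empMean N y v (n + 1) = (1 - 1 / ((count N v n + 1 : ℕ) : ℝ)) * empMean N y v n
      + y (n + 1) / ((count N v n + 1 : ℕ) : ℝ) := by
  unfold empMean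
  rw [count_succ_of_isDescendant h, visits_succ_of_isDescendant h,
    Finset.sum_insert (succ_notMem_visits N v n)]
  -- Without earlier visits the old mean is the default `0`, and its weight `1 - 1 / 1` vanishes
  -- anyway.
  rcases Nat.eq_zero_or_pos (count N v n) with h0 | h0
  · have : visits N v n = ∅ := by simpa [count] using h0
    simp [h0, this]
  · have : (0 : ℝ) < count N v n := by exact_mod_cast h0
    push_cast
    field_simp
    ring

lemma count_pos {N : ℕ → Node} {v : Node} {n : ℕ} :
    0 < count N v n ↔ ∃ t, (1 ≤ t ∧ t ≤ n) ∧ IsDescendant v (N t) := by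
  simp only [count, Finset.card_pos, Finset.Nonempty, mem_visits]

section Algorithm

variable {ν₁ ρ : ℝ} {n₀ : ℕ} {N : ℕ → Node} {y : ℕ → ℝ} {n : ℕ}

lemma UValue_succ_of_not {v : Node} (h : ¬ IsDescendant v (N (n + 1))) :
    UValue ν₁ ρ n₀ N y (n + 1) v = UValue ν₁ ρ n₀ N y n v := by
  simp [UValue, count, empMean, visits_succ_of_not h]

lemma BAux_of_notMem {k : ℕ} {v : Node} (h : v ∉ tree N n) : BAux ν₁ ρ n₀ N y n k v = ⊤ := by
  cases k <;> simp [BAux, h]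

lemma mem_tree_succ_of_not {v : Node} (h : ¬ IsDescendant v (N (n + 1))) :
    v ∈ tree N (n + 1) ↔ v ∈ tree N n := by
  rw [mem_tree_succ]
  refine or_iff_left ?_
  intro e
  exact h (e ▸ IsDescendant.refl _)

/-- If `v` is not an ancestor of the node played, neither is anything below `v`, so nothing entering
the recursion changes. This is what makes local recomputation sufficient. -/
lemma BAux_succ_of_not {k : ℕ} {v : Node} (h : ¬ IsDescendant v (N (n + 1))) :
    BAux ν₁ ρ n₀ N y (n + 1) k v = BAux ν₁ ρ n₀ N y n k v := by
  induction k generalizing v with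
  | zero => 
    by_cases hv : v ∈ tree N n <;>
      simp [BAux, mem_tree_succ_of_not h, UValue_succ_of_not h, hv]
  | succ k ih =>
    simp only [BAux, UValue_succ_of_not h]
    rw [ih fun h' => h ((isDescendant_child₁ v).trans h'),
      ih fun h' => h ((isDescendant_child₂ v).trans h')]
    by_cases hv : v ∈ tree N n <;> simp [mem_tree_succ_of_not h, hv]

/-! ### The stored tree -/

open Classical in
/-- The data structure for the subtree of `v` with `k` further levels after `n` rounds. -/
noncomputable def stored (ν₁ ρ : ℝ) (n₀ : ℕ) (N : ℕ → Node) (y : ℕ → ℝ) (n : ℕ) :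
    ℕ → Node → HTree
  | 0, v =>
    if v ∈ tree N n then
      .node (count N v n) (empMean N y v n) (BAux ν₁ ρ n₀ N y n 0 v) .nil .nil
    else .nil
  | k + 1, v =>
    if v ∈ tree N n then
      .node (count N v n) (empMean N y v n) (BAux ν₁ ρ n₀ N y n (k + 1) v)
        (stored ν₁ ρ n₀ N y n k (child₁ v)) (stored ν₁ ρ n₀ N y n k (child₂ v))
    else .nil

lemma stored_of_notMem {k : ℕ} {v : Node} (h : v ∉ tree N n) :
    stored ν₁ ρ n₀ N y n k v = .nil := by
  cases k <;> simp [stored, h]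

lemma storedB_stored (k : ℕ) (v : Node) :
    (stored ν₁ ρ n₀ N y n k v).storedB = BAux ν₁ ρ n₀ N y n k v := by
  by_cases h : v ∈ tree N n
  · cases k <;> simp [stored, h, HTree.storedB]
  · simp [stored_of_notMem h, BAux_of_notMem h, HTree.storedB]

lemma stored_succ_of_not {k : ℕ} {v : Node} (h : ¬ IsDescendant v (N (n + 1))) :
    stored ν₁ ρ n₀ N y (n + 1) k v = stored ν₁ ρ n₀ N y n k v := by
  induction k generalizing v with
  | zero =>
    by_cases hv : v ∈ tree N n <;>
      simp [stored, mem_tree_succ_of_not h, BAux_succ_of_not h, count, empMean,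
        visits_succ_of_not h, hv]
  | succ k ih =>
    simp only [stored, BAux_succ_of_not h, count, empMean, visits_succ_of_not h]
    rw [ih fun h' => h ((isDescendant_child₁ v).trans h'),
      ih fun h' => h ((isDescendant_child₂ v).trans h')]
    by_cases hv : v ∈ tree N n <;> simp [mem_tree_succ_of_not h, hv]

/-- `Turns N n k v p w`: with at most `k` further levels to go, the turns `p` lead from `v`
through nodes of the tree to the node `w`, where the traversal has to stop. -/
inductive Turns (N : ℕ → Node) (n : ℕ) : ℕ → Node → List Bool → Node → Prop
  | halt (k : ℕ) (v : Node) (h : v ∈ tree N n → k = 0) : Turns N n k v [] v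
  | left (k : ℕ) (v w : Node) (p : List Bool) (h : v ∈ tree N n)
      (h' : Turns N n k (child₁ v) p w) : Turns N n (k + 1) v (true :: p) w
  | right (k : ℕ) (v w : Node) (p : List Bool) (h : v ∈ tree N n)
      (h' : Turns N n k (child₂ v) p w) : Turns N n (k + 1) v (false :: p) w

lemma Turns.isDescendant {k : ℕ} {v w : Node} {p : List Bool} (h : Turns N n k v p w) :
    IsDescendant v w := by
  induction h with
  | halt => exact IsDescendant.refl _
  | left k v w p _ _ ih => exact (isDescendant_child₁ v).trans ih
  | right k v w p _ _ ih => exact (isDescendant_child₂ v).trans ih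

lemma Turns.notMem_or {k : ℕ} {v w : Node} {p : List Bool} (h : Turns N n k v p w) :
    w ∉ tree N n ∨ w.1 = v.1 + k := by
  induction h with
  | halt k v h =>
    by_cases h' : v ∈ tree N n
    · right; simp [h h']
    · exact Or.inl h'
  | left k v w p _ _ ih =>
    refine ih.imp_right fun h => ?_
    simp only [child₁] at h; omega
  | right k v w p _ _ ih =>
    refine ih.imp_right fun h => ?_
    simp only [child₂] at h; omega

lemma refresh_val (c w z : ℝ) (T : ℕ) (m : ℝ) (l r : HTree) :
    (refresh c w z T m l r).val = .node (T + 1)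
      ((1 - 1 / ((T + 1 : ℕ) : ℝ)) * m + z / ((T + 1 : ℕ) : ℝ))
      (min (((1 - 1 / ((T + 1 : ℕ) : ℝ)) * m + z / ((T + 1 : ℕ) : ℝ)
        + Real.sqrt (c / ((T + 1 : ℕ) : ℝ)) + w : ℝ) : EReal) (max l.storedB r.storedB)) l r := rfl

lemma refresh_time (c w z : ℝ) (T : ℕ) (m : ℝ) (l r : HTree) :
    (refresh c w z T m l r).time = 15 := rfl

lemma UValue_succ_of_isDescendant {v : Node} (h : IsDescendant v (N (n + 1))) :
    UValue ν₁ ρ n₀ N y (n + 1) v =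
      (((1 - 1 / ((count N v n + 1 : ℕ) : ℝ)) * empMean N y v n
        + y (n + 1) / ((count N v n + 1 : ℕ) : ℝ)
        + Real.sqrt (2 * Real.log n₀ / ((count N v n + 1 : ℕ) : ℝ)) + ν₁ * ρ ^ v.1 : ℝ) : EReal) := by
  rw [UValue, if_pos (by rw [count_succ_of_isDescendant h]; omega),
    empMean_succ_of_isDescendant y h, count_succ_of_isDescendant h]

/-- The running-mean formula and the `B`-recursion are exactly what `refresh` computes, provided
that the subtrees of the children are already up to date. -/
lemma refresh_stored {v : Node} (h : IsDescendant v (N (n + 1))) (hv : v ∈ tree N (n + 1)) (k : ℕ) :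
    (refresh (2 * Real.log n₀) (ν₁ * ρ ^ v.1) (y (n + 1)) (count N v n) (empMean N y v n)
      (stored ν₁ ρ n₀ N y (n + 1) k (child₁ v)) (stored ν₁ ρ n₀ N y (n + 1) k (child₂ v))).val
    = stored ν₁ ρ n₀ N y (n + 1) (k + 1) v := by
  rw [refresh_val]
  simp only [stored, hv, if_true, BAux, storedB_stored, UValue_succ_of_isDescendant h]
  rw [count_succ_of_isDescendant h, empMean_succ_of_isDescendant y h]

lemma refresh_stored_zero {v : Node} (h : IsDescendant v (N (n + 1)))
    (hv : v ∈ tree N (n + 1)) :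
    (refresh (2 * Real.log n₀) (ν₁ * ρ ^ v.1) (y (n + 1)) (count N v n) (empMean N y v n)
      .nil .nil).val
    = stored ν₁ ρ n₀ N y (n + 1) 0 v := by
  rw [refresh_val]
  simp only [stored, hv, if_true, BAux, HTree.storedB, UValue_succ_of_isDescendant h]
  rw [count_succ_of_isDescendant h, empMean_succ_of_isDescendant y h]
  simp

/-- The tree contains the ancestors of the nodes played. -/
def AncestorClosed (N : ℕ → Node) (n : ℕ) : Prop :=
  ∀ t, 1 ≤ t → t ≤ n → ∀ v, IsDescendant root v → IsDescendant v (N t) → v ∈ tree N n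

/-- Induction along the path: the child on the path is correct by induction, its sibling because it
is not an ancestor of the node played, and then `refresh_stored` applies. Ancestor-closedness is
needed at the end of the path, where a new node must start with an empty record. -/
lemma update_stored (hcl : AncestorClosed N n) {k : ℕ} {v : Node} {p : List Bool}
    (h : Turns N n k v p (N (n + 1))) (hv : IsDescendant root v) :
    (update ρ (2 * Real.log n₀) (y (n + 1)) p (ν₁ * ρ ^ v.1) (stored ν₁ ρ n₀ N y n k v)).val
      = stored ν₁ ρ n₀ N y (n + 1) k v := by
  have hv1 := hv.one_le (by simp [root])
  generalize hw : N (n + 1) = w at h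
  induction h with
  | halt k v h =>
    have hd : IsDescendant v (N (n + 1)) := hw ▸ IsDescendant.refl _
    have hm : v ∈ tree N (n + 1) := (mem_tree_succ ..).2 (Or.inr hw)
    by_cases hvt : v ∈ tree N n
    · obtain rfl := h hvt
      rw [← refresh_stored_zero hd hm]
      simp only [stored, hvt, if_true]
      rfl
    · rw [stored_of_notMem hvt]
      have h0 : count N v n = 0 := by
        by_contra h0
        obtain ⟨t, ⟨h1, h2⟩, h3⟩ := count_pos.1 (Nat.pos_of_ne_zero h0)
        exact hvt (hcl t h1 h2 v hv h3)
      have hm0 : empMean N y v n = 0 := by simp [empMean, h0]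
      -- A proper descendant of `v` in the new tree would have been played earlier, which would have
      -- put `v` in the old tree.
      have hcl1 : ∀ c : Node, IsDescendant v c → v.1 < c.1 → c ∉ tree N (n + 1) := by
        intro c hc hlt hmem
        rcases (mem_tree_succ ..).1 hmem with h | h
        · rcases h with rfl | ⟨t, h1, h2, rfl⟩
          · simp [root] at hlt
          · exact hvt (hcl t h1 h2 v hv hc)
        · rw [hw] at h; subst h; omega
      cases k with
      | zero =>
        rw [← refresh_stored_zero hd hm, h0, hm0]
        rfl
      | succ k =>
        rw [← refresh_stored hd hm, h0, hm0,
          stored_of_notMem (hcl1 _ (isDescendant_child₁ v) (by simp [child₁])),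
          stored_of_notMem (hcl1 _ (isDescendant_child₂ v) (by simp [child₂]))]
        rfl
  | left k v w p hvt h' ih =>
    have hd₁ : IsDescendant (child₁ v) (N (n + 1)) := hw ▸ h'.isDescendant
    have hd : IsDescendant v (N (n + 1)) := (isDescendant_child₁ v).trans hd₁
    have hm : v ∈ tree N (n + 1) := (mem_tree_succ ..).2 (Or.inl hvt)
    have hn : ¬ IsDescendant (child₂ v) (N (n + 1)) := not_isDescendant_both hv1 hd₁
    have ih := ih (hv.trans (isDescendant_child₁ v)) (by simp only [child₁]; omega) hw
    rw [← refresh_stored hd hm, ← ih, stored_succ_of_not hn]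
    simp only [stored, hvt, if_true]
    simp only [child₁, pow_succ, ← mul_assoc]
    rfl
  | right k v w p hvt h' ih =>
    have hd₁ : IsDescendant (child₂ v) (N (n + 1)) := hw ▸ h'.isDescendant
    have hd : IsDescendant v (N (n + 1)) := (isDescendant_child₂ v).trans hd₁
    have hm : v ∈ tree N (n + 1) := (mem_tree_succ ..).2 (Or.inl hvt)
    have hn : ¬ IsDescendant (child₁ v) (N (n + 1)) := fun h => not_isDescendant_both hv1 h hd₁
    have ih := ih (hv.trans (isDescendant_child₂ v)) (by simp only [child₂]; omega) hw
    rw [← refresh_stored hd hm, ← ih, stored_succ_of_not hn]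
    simp only [stored, hvt, if_true]
    simp only [child₂, pow_succ, ← mul_assoc]
    rfl

/-! ### The traversal -/

lemma select_nil (tie : Node → Bool) (k : ℕ) (v : Node) :
    (select tie k v .nil).val = (v, []) := by
  cases k <;> rfl

/-- The part of a step of the traversal that follows the choice of the turn. -/
noncomputable def descend (tie : Node → Bool) (k : ℕ) (v : Node) (l r : HTree) (turn : Bool) :
    Timed (Node × List Bool) :=
  if turn then
    ⟨((select tie k (child₁ v) l).val.1, true :: (select tie k (child₁ v) l).val.2),
      1 + ((select tie k (child₁ v) l).time + 1)⟩
  else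
    ⟨((select tie k (child₂ v) r).val.1, false :: (select tie k (child₂ v) r).val.2),
      (select tie k (child₂ v) r).time + 1⟩

lemma select_node (tie : Node → Bool) (k : ℕ) (v : Node) (T : ℕ) (m : ℝ) (B : EReal)
    (l r : HTree) :
    (select tie (k + 1) v (.node T m B l r)).val = (descend tie k v l r
      (decide (r.storedB < l.storedB) || (!decide (l.storedB < r.storedB) && tie v))).val ∧
    (select tie (k + 1) v (.node T m B l r)).time = 8 + (descend tie k v l r
      (decide (r.storedB < l.storedB) || (!decide (l.storedB < r.storedB) && tie v))).time := by
  refine ⟨rfl, ?_⟩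
  have : (select tie (k + 1) v (.node T m B l r)).time =
    1 + (1 + (1 + (1 + (1 + (1 + (1 + (1 + (descend tie k v l r
      (decide (r.storedB < l.storedB) ||
        (!decide (l.storedB < r.storedB) && tie v))).time))))))) := rfl
  omega

lemma BValue_eq_BAux {k : ℕ} {v : Node} (h : v.1 + k = truncDepth ν₁ ρ n₀) :
    BValue ν₁ ρ n₀ N y n v = BAux ν₁ ρ n₀ N y n k v := by
  rw [BValue, ← h, Nat.add_sub_cancel_left]

/-- Whatever the tie bit, a left turn excludes `b₁ < b₂` and a right turn excludes `b₂ < b₁`, so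
every turn is a greedy step. The recorded turns are those that `update` retraces. -/
lemma select_sound (tie : Node → Bool) {k : ℕ} {v : Node} (hk : v.1 + k = truncDepth ν₁ ρ n₀) :
    Relation.ReflTransGen (GreedyStep ν₁ ρ n₀ N y n) v
      (select tie k v (stored ν₁ ρ n₀ N y n k v)).val.1 ∧
    Turns N n k v (select tie k v (stored ν₁ ρ n₀ N y n k v)).val.2
      (select tie k v (stored ν₁ ρ n₀ N y n k v)).val.1 := by
  induction k generalizing v with
  | zero => exact ⟨.refl, .halt 0 v fun _ => rfl⟩
  | succ k ih =>
    by_cases hvt : v ∈ tree N n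
    · have k1 : (child₁ v).1 + k = truncDepth ν₁ ρ n₀ := by simp only [child₁]; omega
      have k2 : (child₂ v).1 + k = truncDepth ν₁ ρ n₀ := by simp only [child₂]; omega
      simp only [stored, hvt, if_true, (select_node ..).1, storedB_stored, descend]
      split_ifs with h
      · obtain ⟨ih1, ih2⟩ := ih k1
        refine ⟨ih1.head ⟨hvt, by omega, Or.inl ⟨rfl, ?_⟩⟩, .left _ _ _ _ hvt ih2⟩
        rw [BValue_eq_BAux k1, BValue_eq_BAux k2]
        simp only [Bool.or_eq_true, Bool.and_eq_true, decide_eq_true_eq, Bool.not_eq_true',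
          decide_eq_false_iff_not, not_lt] at h
        rcases h with h | h
        · exact h.le
        · exact h.1
      · obtain ⟨ih1, ih2⟩ := ih k2
        refine ⟨ih1.head ⟨hvt, by omega, Or.inr ⟨rfl, ?_⟩⟩, .right _ _ _ _ hvt ih2⟩
        rw [BValue_eq_BAux k1, BValue_eq_BAux k2]
        simp only [Bool.or_eq_true, Bool.and_eq_true, decide_eq_true_eq, Bool.not_eq_true',
          decide_eq_false_iff_not, not_or, not_lt] at h
        exact h.1
    · rw [stored_of_notMem hvt, select_nil]
      exact ⟨.refl, .halt _ _ fun h => absurd h hvt⟩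

lemma isDescendant_of_greedy {v w : Node}
    (h : Relation.ReflTransGen (GreedyStep ν₁ ρ n₀ N y n) v w) : IsDescendant v w := by
  refine Relation.ReflTransGen.mono ?_ _ _ h
  rintro a b ⟨_, _, h | h⟩
  · exact Or.inl h.1
  · exact Or.inr h.1

open Classical in
-- The tie bits point towards `w`. A strict inequality cannot lead elsewhere, since the greedy path
-- to `w` is unique as a path and satisfies the weak inequalities.
lemma select_complete {k : ℕ} {v w : Node} (hv : 1 ≤ v.2) (hk : v.1 + k = truncDepth ν₁ ρ n₀)
    (h : Relation.ReflTransGen (GreedyStep ν₁ ρ n₀ N y n) v w)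
    (hw : w ∉ tree N n ∨ w.1 = truncDepth ν₁ ρ n₀) :
    (select (fun u => decide (IsDescendant (child₁ u) w)) k v
      (stored ν₁ ρ n₀ N y n k v)).val.1 = w := by
  induction k generalizing v with
  | zero =>
    rcases Relation.ReflTransGen.cases_head h with rfl | ⟨c, hc, _⟩
    · rfl
    · have := hc.2.1; omega
  | succ k ih =>
    by_cases hvt : v ∈ tree N n
    · have k1 : (child₁ v).1 + k = truncDepth ν₁ ρ n₀ := by simp only [child₁]; omega
      have k2 : (child₂ v).1 + k = truncDepth ν₁ ρ n₀ := by simp only [child₂]; omega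
      simp only [stored, hvt, if_true, (select_node ..).1, storedB_stored, descend]
      rcases Relation.ReflTransGen.cases_head h with rfl | ⟨c, hc, hcw⟩
      · rcases hw with hw | hw
        · exact absurd hvt hw
        · omega
      · obtain ⟨-, -, ⟨rfl, hB⟩ | ⟨rfl, hB⟩⟩ := hc
        · rw [BValue_eq_BAux k1, BValue_eq_BAux k2] at hB
          have hd := isDescendant_of_greedy hcw
          rw [if_pos (by simp [hd, hB])]
          exact ih (by simp only [child₁]; omega) k1 hcw
        · rw [BValue_eq_BAux k1, BValue_eq_BAux k2] at hB
          have hd : ¬ IsDescendant (child₁ v) w := fun h' =>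
            not_isDescendant_both hv h' (isDescendant_of_greedy hcw)
          rw [if_neg (by simp [hd, hB])]
          exact ih (by simp only [child₂]; omega) k2 hcw
    · rw [stored_of_notMem hvt, select_nil]
      rcases Relation.ReflTransGen.cases_head h with h | ⟨c, hc, _⟩
      · exact h
      · exact absurd hc.1 hvt

/-- In each round, an ancestor of the node selected is this node or belongs to the tree. -/
lemma mem_tree_or_eq_of_greedy {v u w : Node} (hv : 1 ≤ v.2)
    (h : Relation.ReflTransGen (GreedyStep ν₁ ρ n₀ N y n) v w)
    (hu : IsDescendant v u) (huw : IsDescendant u w) :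
    Relation.ReflTransGen (GreedyStep ν₁ ρ n₀ N y n) v u ∧ (u ∈ tree N n ∨ u = w) := by
  induction h using Relation.ReflTransGen.head_induction_on with
  | refl =>
    obtain rfl := hu.eq_of_depth_le huw.depth_le
    exact ⟨.refl, Or.inr rfl⟩
  | head hac hcw ih =>
    rename_i a c
    rcases hu.eq_or with rfl | hu
    · exact ⟨.refl, Or.inl hac.1⟩
    · have hcw' := isDescendant_of_greedy hcw
      have hcu : IsDescendant c u := by
        obtain ⟨-, -, ⟨rfl, -⟩ | ⟨rfl, -⟩⟩ := hac
        · exact hu.resolve_right fun h => not_isDescendant_both hv hcw' (h.trans huw)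
        · exact hu.resolve_left fun h => not_isDescendant_both hv (h.trans huw) hcw'
      have hc : 1 ≤ c.2 := by
        obtain ⟨-, -, ⟨rfl, -⟩ | ⟨rfl, -⟩⟩ := hac <;> simp only [child₁, child₂] <;> omega
      obtain ⟨h1, h2⟩ := ih hc hcu
      exact ⟨h1.head hac, h2⟩

lemma ancestorClosed_of_selectable
    (h : ∀ t, 1 ≤ t → t ≤ n → Selectable ν₁ ρ n₀ N y (t - 1) (N t)) : AncestorClosed N n := by
  intro t h1 h2 v hv hvt
  rcases (mem_tree_or_eq_of_greedy (by simp [root]) (h t h1 h2).1 hv hvt).2 with h' | h'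
  · rcases h' with h' | ⟨s, hs1, hs2, hs3⟩
    · exact Or.inl h'
    · exact Or.inr ⟨s, hs1, by omega, hs3⟩
  · exact Or.inr ⟨t, h1, h2, h'.symm⟩

/-! ### The program plays as truncated HOO does -/

/-- The outcome of the traversal in round `n + 1` of the program. -/
noncomputable def selection (D : ℕ) (ν₁ ρ c : ℝ) (tie : ℕ → Node → Bool) (y : ℕ → ℝ) (n : ℕ) :
    Node × List Bool :=
  (select (tie (n + 1)) D root (rounds D ν₁ ρ c tie y n).val.1).val

lemma rounds_succ_val (D : ℕ) (ν₁ ρ c : ℝ) (tie : ℕ → Node → Bool) (y : ℕ → ℝ) (n : ℕ) :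
    (rounds D ν₁ ρ c tie y (n + 1)).val =
      ((update ρ c (y (n + 1)) (selection D ν₁ ρ c tie y n).2 ν₁
        (rounds D ν₁ ρ c tie y n).val.1).val,
        (selection D ν₁ ρ c tie y n).1 :: (rounds D ν₁ ρ c tie y n).val.2) := rfl

lemma rounds_val_snd (D : ℕ) (ν₁ ρ c : ℝ) (tie : ℕ → Node → Bool) (y : ℕ → ℝ) (n : ℕ) :
    (rounds D ν₁ ρ c tie y n).val.2.reverse =
      (List.range n).map fun t => (selection D ν₁ ρ c tie y t).1 := by
  induction n with
  | zero => rfl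
  | succ n ih => rw [rounds_succ_val, List.reverse_cons, ih, List.range_succ, List.map_append]; rfl

lemma program_val (tie : ℕ → Node → Bool) :
    (program ν₁ ρ n₀ tie y).val =
      (rounds (truncDepth ν₁ ρ n₀) ν₁ ρ (2 * Real.log n₀) tie y n₀).val.2 := rfl

lemma tree_zero (N : ℕ → Node) : tree N 0 = {root} := by
  ext v
  simp only [tree, Set.mem_ofPred_eq, Set.mem_singleton_iff]
  refine or_iff_left ?_
  rintro ⟨t, h1, h2, -⟩; omega

lemma stored_zero (hD : 1 ≤ truncDepth ν₁ ρ n₀) :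
    stored ν₁ ρ n₀ N y 0 (truncDepth ν₁ ρ n₀) root = .node 0 0 ⊤ .nil .nil := by
  obtain ⟨k, hk⟩ : ∃ k, truncDepth ν₁ ρ n₀ = k + 1 := ⟨_, (Nat.sub_add_cancel hD).symm⟩
  have h1 : child₁ root ∉ tree N 0 := by simp [tree_zero, child₁, root]
  have h2 : child₂ root ∉ tree N 0 := by simp [tree_zero, child₂, root]
  have h0 : count N root 0 = 0 := by simp [count, visits_zero]
  rw [hk]
  simp [stored, root_mem_tree, stored_of_notMem h1, stored_of_notMem h2, BAux, BAux_of_notMem h1,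
    BAux_of_notMem h2, h0, UValue, empMean]

/-- The invariant of the main loop. Both parts are proved together: selectability in the earlier
rounds gives ancestor-closedness, which `update_stored` needs for the tree of the next round. -/
lemma rounds_val_fst_of_selection {tie : ℕ → Node → Bool} (hD : 1 ≤ truncDepth ν₁ ρ n₀)
    (h : ∀ t < n,
      N (t + 1) = (selection (truncDepth ν₁ ρ n₀) ν₁ ρ (2 * Real.log n₀) tie y t).1) :
    (rounds (truncDepth ν₁ ρ n₀) ν₁ ρ (2 * Real.log n₀) tie y n).val.1
      = stored ν₁ ρ n₀ N y n (truncDepth ν₁ ρ n₀) root ∧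
    ∀ t, 1 ≤ t → t ≤ n → Selectable ν₁ ρ n₀ N y (t - 1) (N t) := by
  induction n with
  | zero => exact ⟨(stored_zero hD).symm, fun t h1 h2 => by omega⟩
  | succ n ih =>
    obtain ⟨ih1, ih2⟩ := ih fun t ht => h t (by omega)
    have hsel := h n (by omega)
    have hs := select_sound (ν₁ := ν₁) (ρ := ρ) (n₀ := n₀) (N := N) (y := y) (n := n)
      (tie (n + 1)) (v := root)
      (k := truncDepth ν₁ ρ n₀) (by simp [root])
    rw [← ih1] at hs
    change _ ∧ Turns N n _ root (selection _ _ _ _ _ _ n).2 (selection _ _ _ _ _ _ n).1 at hs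
    have hs1 : Relation.ReflTransGen (GreedyStep ν₁ ρ n₀ N y n) root (N (n + 1)) := hsel ▸ hs.1
    rw [← hsel] at hs
    refine ⟨?_, ?_⟩
    · rw [rounds_succ_val, ih1]
      have := update_stored (ν₁ := ν₁) (ρ := ρ) (n₀ := n₀) (y := y)
        (ancestorClosed_of_selectable ih2) hs.2 (IsDescendant.refl _)
      simpa [root] using this
    · intro t h1 h2
      rcases Nat.lt_or_ge n t with h3 | h3
      · obtain rfl : t = n + 1 := by omega
        refine ⟨hs1, ?_⟩
        simpa [root] using hs.2.notMem_or
      · exact ih2 t h1 h3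

lemma program_val_iff {tie : ℕ → Node → Bool} :
    (program ν₁ ρ n₀ tie y).val.reverse = (List.range n₀).map (fun t => N (t + 1)) ↔
      ∀ t < n₀, N (t + 1) =
        (selection (truncDepth ν₁ ρ n₀) ν₁ ρ (2 * Real.log n₀) tie y t).1 := by
  rw [program_val, rounds_val_snd, List.map_inj_left]
  simp [eq_comm]

theorem isTruncatedHOO_iff_program (hD : 1 ≤ truncDepth ν₁ ρ n₀) :
    IsTruncatedHOO ν₁ ρ n₀ N y ↔ ∃ tie : ℕ → Node → Bool,
      (program ν₁ ρ n₀ tie y).val.reverse = (List.range n₀).map fun t => N (t + 1) := by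
  classical
  simp only [program_val_iff]
  constructor
  · intro h
    -- In round `t` the tie bits steer towards the prescribed node `N t`. Strong induction is needed
    -- because the stored tree depends on all earlier selections.
    refine ⟨fun t u => decide (IsDescendant (child₁ u) (N t)), ?_⟩
    intro t
    induction t using Nat.strong_induction_on with
    | _ t ih =>
      intro ht
      have := (rounds_val_fst_of_selection (N := N) (n := t) hD
        fun s hs => ih s hs (by omega)).1
      have hsel := h (t + 1) (by omega) (by omega)
      rw [selection, this]
      exact (select_complete (by simp [root]) (by simp [root]) hsel.1 hsel.2).symm
  · rintro ⟨tie, h⟩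
    exact (rounds_val_fst_of_selection hD h).2

/-! ### Running time -/

/-- Per level, eight operations choose the turn and at most two more carry out the descent. -/
lemma select_time_le (tie : Node → Bool) (k : ℕ) (v : Node) (t : HTree) :
    (select tie k v t).time ≤ 10 * k + 1 ∧ (select tie k v t).val.2.length ≤ k := by
  induction k generalizing v t with
  | zero => exact ⟨le_rfl, le_rfl⟩
  | succ k ih =>
    cases t with
    | nil => exact ⟨by simp [select, step], by simp [select, step]⟩
    | node T m B l r =>
      have h₁ := ih (child₁ v) l
      have h₂ := ih (child₂ v) r
      rw [(select_node ..).1, (select_node ..).2]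
      unfold descend
      split_ifs <;> simp only [List.length_cons] <;> omega

/-- A call of `refresh` costs 15, with two more operations per turn and one more at the end of the
path. -/
lemma update_time_le (ρ c z : ℝ) (p : List Bool) (w : ℝ) (t : HTree) :
    (update ρ c z p w t).time ≤ 17 * p.length + 16 := by
  induction p generalizing w t with
  | nil => cases t <;> simp [update, Bind.bind, step, refresh_time]
  | cons b p ih =>
    cases t with
    | nil => simp only [update, step]; omega
    | node T m B l r =>
      cases b
      · have := ih (w * ρ) r
        simp only [update, Bind.bind, step, refresh_time, List.length_cons, Bool.false_eq_true,
          if_false]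
        omega
      · have := ih (w * ρ) l
        simp only [update, Bind.bind, step, refresh_time, List.length_cons, if_true]
        omega

lemma rounds_time_le (D : ℕ) (ν₁ ρ c : ℝ) (tie : ℕ → Node → Bool) (y : ℕ → ℝ) (n : ℕ) :
    (rounds D ν₁ ρ c tie y n).time ≤ n * (27 * D + 21) + 1 := by
  induction n with
  | zero => simp [rounds, step]
  | succ n ih =>
    have h1 := select_time_le (tie (n + 1)) D root (rounds D ν₁ ρ c tie y n).val.1
    have h2 := update_time_le ρ c (y (n + 1))
      (select (tie (n + 1)) D root (rounds D ν₁ ρ c tie y n).val.1).val.2 ν₁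
      (rounds D ν₁ ρ c tie y n).val.1
    simp only [rounds, Bind.bind, step]
    have : (n + 1) * (27 * D + 21) = n * (27 * D + 21) + (27 * D + 21) := by ring
    omega

lemma program_time_le (tie : ℕ → Node → Bool) :
    (program ν₁ ρ n₀ tie y).time ≤ n₀ * (27 * truncDepth ν₁ ρ n₀ + 21) + 12 := by
  have h := rounds_time_le (truncDepth ν₁ ρ n₀) ν₁ ρ (2 * Real.log n₀) tie y n₀
  have : (program ν₁ ρ n₀ tie y).time =
      10 + (rounds (truncDepth ν₁ ρ n₀) ν₁ ρ (2 * Real.log n₀) tie y n₀).time + 1 := by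
    simp only [program, Bind.bind, step, truncDepth]
    omega
  omega

/-- The truncation depth is logarithmic in the horizon. -/
lemma exists_truncDepth_le (ν₁ : ℝ) {ρ : ℝ} (hρ₀ : 0 < ρ) (hρ₁ : ρ < 1) :
    ∃ K : ℝ, 1 ≤ K ∧ ∀ n₀ : ℕ, 2 ≤ n₀ → (truncDepth ν₁ ρ n₀ : ℝ) ≤ K * Real.log n₀ := by
  have hlr : 0 < Real.log (1 / ρ) := Real.log_pos (by rw [lt_div_iff₀ hρ₀]; linarith)
  have hl2 : 0 < Real.log 2 := Real.log_pos (by norm_num)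
  set a := |Real.log (1 / ν₁)| with ha
  have ha0 : 0 ≤ a := abs_nonneg _
  -- Constants are absorbed through `ln 2 ≤ ln n₀`. The last summand pays for rounding up; the first
  -- one only secures `1 ≤ K`.
  refine ⟨1 + (1 / 2 + a / Real.log 2) / Real.log (1 / ρ) + 1 / Real.log 2, ?_, ?_⟩
  · have : 0 ≤ (1 / 2 + a / Real.log 2) / Real.log (1 / ρ) + 1 / Real.log 2 := by positivity
    linarith
  intro n₀ hn
  have hL : Real.log 2 ≤ Real.log n₀ := Real.log_le_log (by norm_num) (by exact_mod_cast hn)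
  have hx : (Real.log n₀ / 2 - Real.log (1 / ν₁)) / Real.log (1 / ρ) ≤
      (1 / 2 + a / Real.log 2) / Real.log (1 / ρ) * Real.log n₀ := by
    rw [div_mul_eq_mul_div]
    refine div_le_div_of_nonneg_right ?_ hlr.le
    have h1 : -Real.log (1 / ν₁) ≤ a := neg_le_abs _
    have h2 : a ≤ a / Real.log 2 * Real.log n₀ := by
      rw [div_mul_eq_mul_div, le_div_iff₀ hl2]
      exact mul_le_mul_of_nonneg_left hL ha0
    linarith
  have hone : 1 ≤ 1 / Real.log 2 * Real.log n₀ := by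
    rw [one_div_mul_eq_div, le_div_iff₀ hl2]; linarith
  have h0 : 0 ≤ (1 / 2 + a / Real.log 2) / Real.log (1 / ρ) * Real.log n₀ := by
    have : 0 ≤ Real.log n₀ := by linarith
    positivity
  have hc : (truncDepth ν₁ ρ n₀ : ℝ) ≤
      (1 / 2 + a / Real.log 2) / Real.log (1 / ρ) * Real.log n₀ + 1 :=
    (Nat.cast_le.2 (Nat.ceil_mono hx)).trans (Nat.ceil_lt_add_one h0).le
  have : 0 ≤ Real.log n₀ := by linarith
  linarith

theorem exists_program_time_le (ν₁ : ℝ) {ρ : ℝ} (hρ₀ : 0 < ρ) (hρ₁ : ρ < 1) :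
    ∃ C : ℝ, ∀ n₀ : ℕ, 2 ≤ n₀ → ∀ (tie : ℕ → Node → Bool) (y : ℕ → ℝ),
      ((program ν₁ ρ n₀ tie y).time : ℝ) ≤ C * (n₀ * Real.log n₀) := by
  obtain ⟨K, hK1, hK⟩ := exists_truncDepth_le ν₁ hρ₀ hρ₁
  have hl2 : 0 < Real.log 2 := Real.log_pos (by norm_num)
  refine ⟨27 * K + 33 / Real.log 2, fun n₀ hn tie y => ?_⟩
  have hL : Real.log 2 ≤ Real.log n₀ := Real.log_le_log (by norm_num) (by exact_mod_cast hn)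
  have hn1 : (1 : ℝ) ≤ n₀ := by exact_mod_cast (by omega : 1 ≤ n₀)
  have h := program_time_le (ν₁ := ν₁) (ρ := ρ) (n₀ := n₀) (y := y) tie
  have h' : ((program ν₁ ρ n₀ tie y).time : ℝ) ≤ n₀ * (27 * truncDepth ν₁ ρ n₀ + 21) + 12 := by
    exact_mod_cast h
  have hone : 1 ≤ 1 / Real.log 2 * Real.log n₀ := by
    rw [one_div_mul_eq_div, le_div_iff₀ hl2]; linarith
  calc _ ≤ _ := h'
    _ ≤ n₀ * (27 * (K * Real.log n₀) + 21) + 12 * n₀ := by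
        have := hK n₀ hn
        gcongr
        linarith
    _ ≤ n₀ * (27 * (K * Real.log n₀) + 33 * (1 / Real.log 2 * Real.log n₀)) := by
        nlinarith
    _ = _ := by ring

end Algorithm

/-! ### Bounded random variables with a given conditional law -/

section CondLaw

/-- The lower approximation of `y ∈ [0, 1]` by multiples of `1 / k`. -/
noncomputable def gridSum (k : ℕ) (y : ℝ) : ℝ :=
  1 / (k : ℝ) * ∑ j ∈ Finset.Icc 1 k, (Set.Ici ((j : ℝ) / k)).indicator (fun _ => (1 : ℝ)) y

lemma abs_sub_gridSum_le {k : ℕ} (hk : 0 < k) {y : ℝ} (hy : y ∈ Set.Icc (0 : ℝ) 1) :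
    |y - gridSum k y| ≤ 1 / k := by
  have hk' : (0 : ℝ) < k := by exact_mod_cast hk
  -- The sum counts the `j ≥ 1` with `j ≤ k y`.
  have hsum : ∑ j ∈ Finset.Icc 1 k, (Set.Ici ((j : ℝ) / k)).indicator (fun _ => (1 : ℝ)) y
      = (⌊k * y⌋₊ : ℝ) := by
    have : ∀ j ∈ Finset.Icc 1 k, (Set.Ici ((j : ℝ) / k)).indicator (fun _ => (1 : ℝ)) y
        = if j ≤ ⌊k * y⌋₊ then 1 else 0 := by
      intro j hj
      have : y ∈ Set.Ici ((j : ℝ) / k) ↔ j ≤ ⌊k * y⌋₊ := by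
        rw [Set.mem_Ici, div_le_iff₀ hk', Nat.le_floor_iff (mul_nonneg hk'.le hy.1), mul_comm y]
      simp only [Set.indicator, this]
    rw [Finset.sum_congr rfl this, Finset.sum_ite, Finset.sum_const_zero, add_zero,
      Finset.sum_const, nsmul_eq_mul, mul_one]
    have hle : ⌊k * y⌋₊ ≤ k := Nat.floor_le_of_le (by nlinarith [hy.2])
    have : (Finset.Icc 1 k).filter (fun j => j ≤ ⌊k * y⌋₊) = Finset.Icc 1 ⌊k * y⌋₊ := by
      ext j; simp only [Finset.mem_filter, Finset.mem_Icc]; omega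
    rw [this, Nat.card_Icc, Nat.add_sub_cancel]
  have h1 : (⌊k * y⌋₊ : ℝ) ≤ k * y := Nat.floor_le (mul_nonneg hk'.le hy.1)
  have h2 : k * y < ⌊k * y⌋₊ + 1 := Nat.lt_floor_add_one _
  rw [gridSum, hsum, abs_le]
  constructor
  · have : 1 / (k : ℝ) * ⌊k * y⌋₊ ≤ y := by
      rw [one_div_mul_eq_div, div_le_iff₀ hk']; linarith
    have : 0 ≤ 1 / (k : ℝ) := by positivity
    linarith
  · have : y ≤ 1 / (k : ℝ) * ⌊k * y⌋₊ + 1 / k := by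
      rw [one_div_mul_eq_div, ← add_div, le_div_iff₀ hk']; linarith
    linarith

variable {Ω : Type*} {m mΩ : MeasurableSpace Ω} {μ : Measure Ω} [IsProbabilityMeasure μ]
  {κ : Ω → Measure ℝ} {Y : Ω → ℝ}

lemma ae_mem_Icc_of_condLaw (hm : m ≤ mΩ) (hκ : ∀ ω, κ ω (Set.Icc (0 : ℝ) 1)ᶜ = 0)
    (hY : Measurable Y)
    (hlaw : ∀ S : Set ℝ, MeasurableSet S →
      μ[(Y ⁻¹' S).indicator (fun _ => (1 : ℝ)) | m] =ᵐ[μ] fun ω => (κ ω).real S) :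
    ∀ᵐ ω ∂μ, Y ω ∈ Set.Icc (0 : ℝ) 1 := by
  have hS : MeasurableSet (Set.Icc (0 : ℝ) 1)ᶜ := measurableSet_Icc.compl
  have h1 : ∫ ω, (Y ⁻¹' (Set.Icc (0 : ℝ) 1)ᶜ).indicator (fun _ => (1 : ℝ)) ω ∂μ = 0 := by
    rw [← integral_condExp hm, integral_congr_ae (hlaw _ hS)]
    simp [Measure.real, hκ]
  have h2 : μ.real (Y ⁻¹' (Set.Icc (0 : ℝ) 1)ᶜ) = 0 := by
    exact (integral_indicator_one (hY hS)).symm.trans h1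
  rw [measureReal_eq_zero_iff] at h2
  exact h2

lemma integral_mul_indicator_of_condLaw (hm : m ≤ mΩ) (hY : Measurable Y)
    (hlaw : ∀ S : Set ℝ, MeasurableSet S →
      μ[(Y ⁻¹' S).indicator (fun _ => (1 : ℝ)) | m] =ᵐ[μ] fun ω => (κ ω).real S)
    {W : Ω → ℝ} (hW : StronglyMeasurable[m] W) {C : ℝ} (hC : ∀ᵐ ω ∂μ, |W ω| ≤ C)
    {S : Set ℝ} (hS : MeasurableSet S) :
    ∫ ω, W ω * S.indicator (fun _ => (1 : ℝ)) (Y ω) ∂μ = ∫ ω, W ω * (κ ω).real S ∂μ := by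
  have hI : Integrable ((Y ⁻¹' S).indicator (fun _ => (1 : ℝ))) μ :=
    (integrable_const (1 : ℝ)).indicator (hY hS)
  have hWI : Integrable (W * (Y ⁻¹' S).indicator (fun _ => (1 : ℝ))) μ :=
    hI.bdd_mul (hW.mono hm).aestronglyMeasurable hC
  have h := condExp_mul_of_stronglyMeasurable_left hW hWI hI
  have h' : μ[W * (Y ⁻¹' S).indicator (fun _ => (1 : ℝ)) | m] =ᵐ[μ]
      fun ω => W ω * (κ ω).real S := by
    filter_upwards [h, hlaw S hS] with ω h1 h2
    rw [h1, Pi.mul_apply, h2]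
  rw [← integral_congr_ae h', integral_condExp hm]
  rfl

variable [∀ ω, IsProbabilityMeasure (κ ω)]

lemma mean_mem_Icc {ν : Measure ℝ} [IsProbabilityMeasure ν] (hν : ν (Set.Icc (0 : ℝ) 1)ᶜ = 0) :
    ∫ y, y ∂ν ∈ Set.Icc (0 : ℝ) 1 := by
  have hae : ∀ᵐ y ∂ν, y ∈ Set.Icc (0 : ℝ) 1 := hν
  have hint : Integrable (fun y : ℝ => y) ν := by
    refine Integrable.of_bound measurable_id.aestronglyMeasurable 1 ?_
    filter_upwards [hae] with y hy
    rw [Real.norm_eq_abs, abs_le]; exact ⟨by linarith [hy.1], hy.2⟩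
  refine ⟨integral_nonneg_of_ae (hae.mono fun y hy => hy.1), ?_⟩
  calc ∫ y, y ∂ν ≤ ∫ _, (1 : ℝ) ∂ν :=
        integral_mono_ae hint (integrable_const _) (hae.mono fun y hy => hy.2)
    _ = 1 := by simp

lemma abs_mean_sub_le {ν : Measure ℝ} [IsProbabilityMeasure ν]
    (hν : ν (Set.Icc (0 : ℝ) 1)ᶜ = 0) {k : ℕ} (hk : 0 < k) :
    |∫ y, y ∂ν - 1 / (k : ℝ) * ∑ j ∈ Finset.Icc 1 k, ν.real (Set.Ici ((j : ℝ) / k))| ≤ 1 / k := by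
  have hae : ∀ᵐ y ∂ν, y ∈ Set.Icc (0 : ℝ) 1 := hν
  have hint : Integrable (fun y : ℝ => y) ν := by
    refine Integrable.of_bound measurable_id.aestronglyMeasurable 1 ?_
    filter_upwards [hae] with y hy
    rw [Real.norm_eq_abs, abs_le]; exact ⟨by linarith [hy.1], hy.2⟩
  have hi : ∀ j ∈ Finset.Icc 1 k,
      Integrable ((Set.Ici ((j : ℝ) / k)).indicator (fun _ => (1 : ℝ))) ν :=
    fun j _ => (integrable_const (1 : ℝ)).indicator measurableSet_Ici
  have hq : ∫ y, gridSum k y ∂ν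
      = 1 / (k : ℝ) * ∑ j ∈ Finset.Icc 1 k, ν.real (Set.Ici ((j : ℝ) / k)) := by
    unfold gridSum
    rw [integral_const_mul, integral_finsetSum _ hi]
    congr 1
    exact Finset.sum_congr rfl fun j _ => integral_indicator_one measurableSet_Ici
  have hqi : Integrable (gridSum k) ν := (integrable_finsetSum _ hi).const_mul _
  rw [← hq, ← integral_sub hint hqi]
  have := norm_integral_le_of_norm_le_const (μ := ν) (f := fun y => y - gridSum k y) (C := 1 / k)
    (hae.mono fun y hy => abs_sub_gridSum_le hk hy)
  simpa using this

/-- The conditional law is given for one set at a time, each with its own null set, and `κ` is not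
assumed to be a kernel. Replacing `Y` by `gridSum k Y` involves finitely many sets, where the
identity is exact; the error on each side is at most `C / k`, and `k → ∞`. -/
lemma integral_mul_of_condLaw (hm : m ≤ mΩ) (hκ : ∀ ω, κ ω (Set.Icc (0 : ℝ) 1)ᶜ = 0)
    (hY : Measurable Y)
    (hlaw : ∀ S : Set ℝ, MeasurableSet S →
      μ[(Y ⁻¹' S).indicator (fun _ => (1 : ℝ)) | m] =ᵐ[μ] fun ω => (κ ω).real S)
    (hmean : Measurable fun ω => ∫ y, y ∂κ ω)
    {W : Ω → ℝ} (hW : StronglyMeasurable[m] W) {C : ℝ} (hC : ∀ᵐ ω ∂μ, |W ω| ≤ C) :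
    ∫ ω, W ω * Y ω ∂μ = ∫ ω, W ω * ∫ y, y ∂κ ω ∂μ := by
  have hC0 : 0 ≤ C := by
    obtain ⟨ω, hω⟩ := hC.exists
    exact (abs_nonneg _).trans hω
  have hYae := ae_mem_Icc_of_condLaw hm hκ hY hlaw
  have hWm : AEStronglyMeasurable W μ := (hW.mono hm).aestronglyMeasurable
  have hYi : Integrable (fun ω => W ω * Y ω) μ := by
    refine Integrable.bdd_mul (Integrable.of_bound hY.aestronglyMeasurable 1 ?_) hWm hC
    filter_upwards [hYae] with ω hω
    rw [Real.norm_eq_abs, abs_le]; exact ⟨by linarith [hω.1], hω.2⟩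
  have hMi : Integrable (fun ω => W ω * ∫ y, y ∂κ ω) μ := by
    refine Integrable.bdd_mul (Integrable.of_bound hmean.aestronglyMeasurable 1 ?_) hWm hC
    refine ae_of_all _ fun ω => ?_
    have hω := mean_mem_Icc (hκ ω)
    rw [Real.norm_eq_abs, abs_le]; exact ⟨by linarith [hω.1], hω.2⟩
  have hW1 : Integrable W μ := Integrable.of_bound hWm C hC
  have key : ∀ k : ℕ, 0 < k →
      |∫ ω, W ω * Y ω ∂μ - ∫ ω, W ω * ∫ y, y ∂κ ω ∂μ| ≤ 2 * C * (1 / k) := by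
    intro k hk
    have hind : ∀ j ∈ Finset.Icc 1 k, Integrable (fun ω => W ω *
        (Set.Ici ((j : ℝ) / k)).indicator (fun _ => (1 : ℝ)) (Y ω)) μ := fun j _ =>
      ((integrable_const (1 : ℝ)).indicator (hY measurableSet_Ici)).bdd_mul hWm hC
    have hreal : ∀ j ∈ Finset.Icc 1 k, Integrable (fun ω => W ω *
        (κ ω).real (Set.Ici ((j : ℝ) / k))) μ := fun j _ =>
      (integrable_condExp.congr (hlaw _ measurableSet_Ici)).bdd_mul hWm hC
    have hg : ∀ ω, W ω * gridSum k (Y ω) = 1 / (k : ℝ) * ∑ j ∈ Finset.Icc 1 k,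
        W ω * (Set.Ici ((j : ℝ) / k)).indicator (fun _ => (1 : ℝ)) (Y ω) := by
      intro ω
      rw [gridSum, ← Finset.mul_sum]; ring
    have hg' : ∀ ω, W ω * (1 / (k : ℝ) * ∑ j ∈ Finset.Icc 1 k, (κ ω).real (Set.Ici ((j : ℝ) / k)))
        = 1 / (k : ℝ) * ∑ j ∈ Finset.Icc 1 k, W ω * (κ ω).real (Set.Ici ((j : ℝ) / k)) := by
      intro ω
      rw [← Finset.mul_sum]; ring
    have hgi : Integrable (fun ω => W ω * gridSum k (Y ω)) μ := by
      simp only [hg]; exact (integrable_finsetSum _ hind).const_mul _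
    have hgi' : Integrable (fun ω => W ω *
        (1 / (k : ℝ) * ∑ j ∈ Finset.Icc 1 k, (κ ω).real (Set.Ici ((j : ℝ) / k)))) μ := by
      simp only [hg']; exact (integrable_finsetSum _ hreal).const_mul _
    have heq : ∫ ω, W ω * gridSum k (Y ω) ∂μ = ∫ ω, W ω *
        (1 / (k : ℝ) * ∑ j ∈ Finset.Icc 1 k, (κ ω).real (Set.Ici ((j : ℝ) / k))) ∂μ := by
      simp only [hg, hg']
      rw [integral_const_mul, integral_const_mul, integral_finsetSum _ hind,
        integral_finsetSum _ hreal]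
      congr 1
      exact Finset.sum_congr rfl fun j _ =>
        integral_mul_indicator_of_condLaw hm hY hlaw hW hC measurableSet_Ici
    have h1 : |∫ ω, W ω * Y ω ∂μ - ∫ ω, W ω * gridSum k (Y ω) ∂μ| ≤ C * (1 / k) := by
      rw [← integral_sub hYi hgi]
      have := norm_integral_le_of_norm_le_const (μ := μ)
        (f := fun ω => W ω * Y ω - W ω * gridSum k (Y ω)) (C := C * (1 / k)) (by
          filter_upwards [hC, hYae] with ω h1 h2
          rw [← mul_sub, norm_mul]
          exact mul_le_mul h1 (abs_sub_gridSum_le hk h2) (norm_nonneg _) hC0)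
      simpa using this
    have h2 : |∫ ω, W ω * (1 / (k : ℝ) * ∑ j ∈ Finset.Icc 1 k,
        (κ ω).real (Set.Ici ((j : ℝ) / k))) ∂μ - ∫ ω, W ω * ∫ y, y ∂κ ω ∂μ| ≤ C * (1 / k) := by
      rw [abs_sub_comm, ← integral_sub hMi hgi']
      have := norm_integral_le_of_norm_le_const (μ := μ)
        (f := fun ω => W ω * ∫ y, y ∂κ ω - W ω * (1 / (k : ℝ) * ∑ j ∈ Finset.Icc 1 k,
          (κ ω).real (Set.Ici ((j : ℝ) / k)))) (C := C * (1 / k)) (by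
          filter_upwards [hC] with ω h1
          rw [← mul_sub, norm_mul]
          exact mul_le_mul h1 (abs_mean_sub_le (hκ ω) hk) (norm_nonneg _) hC0)
      simpa using this
    rw [heq] at h1
    calc _ ≤ _ := abs_sub_le _ _ _
      _ ≤ _ := add_le_add h1 h2
      _ = _ := by ring
  have hlim : Tendsto (fun k : ℕ => 2 * C * (1 / ((k : ℝ) + 1))) atTop (𝓝 (2 * C * 0)) :=
    tendsto_one_div_add_atTop_nhds_zero_nat.const_mul _
  have hle : |∫ ω, W ω * Y ω ∂μ - ∫ ω, W ω * ∫ y, y ∂κ ω ∂μ| ≤ 2 * C * 0 :=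
    ge_of_tendsto' hlim fun k => by simpa using key (k + 1) k.succ_pos
  rw [mul_zero] at hle
  exact sub_eq_zero.1 (abs_eq_zero.1 (le_antisymm hle (abs_nonneg _)))

/-- Hoeffding's bound on the moment generating function of a Bernoulli variable. -/
lemma one_add_mul_exp_sub_one_le {p : ℝ} (hp : p ∈ Set.Icc (0 : ℝ) 1) (lam : ℝ) :
    1 + p * (Real.exp lam - 1) ≤ Real.exp (lam * p + lam ^ 2 / 8) := by
  -- The Bernoulli law with parameter `p`. Hoeffding's lemma on `[0, 1]` gives the variance proxy `1
  -- / 4`, hence `lam ^ 2 / 8`.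
  set ν : Measure ℝ := ENNReal.ofReal p • Measure.dirac 1 + ENNReal.ofReal (1 - p) • Measure.dirac 0
    with hν
  have h1p : 0 ≤ 1 - p := by linarith [hp.2]
  have hprob : IsProbabilityMeasure ν := ⟨by
    rw [hν]
    simp only [Measure.add_apply, Measure.smul_apply, measure_univ, smul_eq_mul, mul_one]
    rw [← ENNReal.ofReal_add hp.1 h1p]; simp⟩
  have hint : ∀ g : ℝ → ℝ, ∫ x, g x ∂ν = p * g 1 + (1 - p) * g 0 := by
    intro g
    rw [hν, integral_add_measure, integral_smul_measure, integral_smul_measure, integral_dirac,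
      integral_dirac, ENNReal.toReal_ofReal hp.1, ENNReal.toReal_ofReal h1p]
    · rfl
    · exact (integrable_dirac (by simp)).smul_measure (by simp)
    · exact (integrable_dirac (by simp)).smul_measure (by simp)
  have hmem : ∀ᵐ x ∂ν, id x ∈ Set.Icc (0 : ℝ) 1 := by
    rw [hν, ae_add_measure_iff]
    constructor
    · refine Measure.ae_smul_measure ?_ _
      rw [ae_dirac_eq]; simp
    · refine Measure.ae_smul_measure ?_ _
      rw [ae_dirac_eq]; simp
  have h := (ProbabilityTheory.hasSubgaussianMGF_of_mem_Icc (μ := ν) (X := id)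
    measurable_id.aemeasurable
    hmem).mgf_le lam
  rw [ProbabilityTheory.mgf, hint, hint] at h
  have hc : (((‖(1 : ℝ) - 0‖₊ / 2) ^ 2 : NNReal) : ℝ) * lam ^ 2 / 2 = lam ^ 2 / 8 := by
    simp; ring
  rw [hc] at h
  simp only [id, mul_one, mul_zero, add_zero, zero_sub] at h
  calc 1 + p * (Real.exp lam - 1)
      = Real.exp (lam * p) * (p * Real.exp (lam * (1 - p)) + (1 - p) * Real.exp (lam * -p)) := by
        have e1 : Real.exp (lam * p) * Real.exp (lam * (1 - p)) = Real.exp lam := by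
          rw [← Real.exp_add]; ring_nf
        have e2 : Real.exp (lam * p) * Real.exp (lam * -p) = 1 := by
          rw [← Real.exp_add]; ring_nf; simp
        linear_combination (-p) * e1 - (1 - p) * e2
    _ ≤ Real.exp (lam * p) * Real.exp (lam ^ 2 / 8) := by gcongr
    _ = _ := by rw [← Real.exp_add]

/-- By convexity the graph lies below its chord over `[0, 1]`. The bound is affine in `y`, so only
the conditional mean of the reward matters afterwards. -/
lemma exp_mul_le_of_mem_Icc {y : ℝ} (hy : y ∈ Set.Icc (0 : ℝ) 1) (lam : ℝ) :
    Real.exp (lam * y) ≤ 1 + y * (Real.exp lam - 1) := by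
  have := convexOn_exp.2 (Set.mem_univ lam) (Set.mem_univ 0) hy.1
    (by linarith [hy.2] : 0 ≤ 1 - y) (by ring)
  simp only [smul_eq_mul, mul_zero, add_zero, Real.exp_zero] at this
  rw [mul_comm lam y]
  linarith

/-- A weighted form of the conditional Hoeffding inequality. -/
lemma integral_mul_exp_of_condLaw (hm : m ≤ mΩ) (hκ : ∀ ω, κ ω (Set.Icc (0 : ℝ) 1)ᶜ = 0)
    (hY : Measurable Y)
    (hlaw : ∀ S : Set ℝ, MeasurableSet S →
      μ[(Y ⁻¹' S).indicator (fun _ => (1 : ℝ)) | m] =ᵐ[μ] fun ω => (κ ω).real S)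
    (hmean : Measurable[m] fun ω => ∫ y, y ∂κ ω)
    {W : Ω → ℝ} (hW : Measurable[m] W) (hW0 : ∀ ω, 0 ≤ W ω) {C : ℝ}
    (hC : ∀ᵐ ω ∂μ, |W ω| ≤ C) (lam : ℝ) :
    ∫ ω, W ω * Real.exp (lam * (Y ω - ∫ y, y ∂κ ω) - lam ^ 2 / 8) ∂μ ≤ ∫ ω, W ω ∂μ := by
  set f : Ω → ℝ := fun ω => ∫ y, y ∂κ ω with hf
  have hf01 : ∀ ω, f ω ∈ Set.Icc (0 : ℝ) 1 := fun ω => mean_mem_Icc (hκ ω)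
  have hYae := ae_mem_Icc_of_condLaw hm hκ hY hlaw
  -- `V` collects all the `m`-measurable factors, leaving `exp (lam * Y)`.
  set V : Ω → ℝ := fun ω => W ω * Real.exp (-(lam * f ω) - lam ^ 2 / 8) with hV
  have hVm : Measurable[m] V :=
    hW.mul (((hmean.const_mul lam).neg.sub_const _).exp)
  have hfb : ∀ ω, |lam * f ω| ≤ |lam| := fun ω => by
    rw [abs_mul, abs_of_nonneg (hf01 ω).1]
    exact mul_le_of_le_one_right (abs_nonneg _) (hf01 ω).2
  have hVb : ∀ᵐ ω ∂μ, |V ω| ≤ C * Real.exp |lam| := by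
    filter_upwards [hC] with ω h
    rw [hV, abs_mul, Real.abs_exp]
    refine mul_le_mul h (Real.exp_le_exp.2 ?_) (Real.exp_nonneg _) ((abs_nonneg _).trans h)
    nlinarith [(abs_le.1 (hfb ω)).1, sq_nonneg lam]
  have hV0 : ∀ ω, 0 ≤ V ω := fun ω => mul_nonneg (hW0 ω) (Real.exp_nonneg _)
  have hVs : AEStronglyMeasurable V μ := (hVm.mono hm le_rfl).aestronglyMeasurable
  have hVi : Integrable V μ := Integrable.of_bound hVs _ hVb
  have hYi : Integrable (fun ω => V ω * Y ω) μ := by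
    refine Integrable.bdd_mul (Integrable.of_bound hY.aestronglyMeasurable 1 ?_) hVs hVb
    filter_upwards [hYae] with ω hω
    rw [Real.norm_eq_abs, abs_le]; exact ⟨by linarith [hω.1], hω.2⟩
  have hfi : Integrable (fun ω => V ω * f ω) μ := by
    refine Integrable.bdd_mul (Integrable.of_bound
      (hmean.mono hm le_rfl).aestronglyMeasurable 1 ?_) hVs hVb
    refine ae_of_all _ fun ω => ?_
    rw [Real.norm_eq_abs, abs_le]; exact ⟨by linarith [(hf01 ω).1], (hf01 ω).2⟩
  have hWi : Integrable W μ := Integrable.of_bound (hW.mono hm le_rfl).aestronglyMeasurable C hC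
  have hexp : ∀ ω, W ω * Real.exp (lam * (Y ω - f ω) - lam ^ 2 / 8)
      = V ω * Real.exp (lam * Y ω) := by
    intro ω
    rw [hV, mul_assoc, ← Real.exp_add]; ring_nf
  have hLi : Integrable (fun ω => V ω + V ω * Y ω * (Real.exp lam - 1)) μ :=
    hVi.add (hYi.mul_const _)
  have hei : Integrable (fun ω => V ω * Real.exp (lam * Y ω)) μ := by
    refine hLi.mono' (hVs.mul (hY.const_mul lam).exp.aestronglyMeasurable) ?_
    filter_upwards [hYae] with ω hω
    rw [Real.norm_eq_abs, abs_of_nonneg (mul_nonneg (hV0 ω) (Real.exp_nonneg _))]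
    have := mul_le_mul_of_nonneg_left (exp_mul_le_of_mem_Icc hω lam) (hV0 ω)
    linarith
  -- Chord bound, then `Y` replaced by its conditional mean, then the Bernoulli bound, which cancels
  -- the exponential in `V`.
  calc ∫ ω, W ω * Real.exp (lam * (Y ω - f ω) - lam ^ 2 / 8) ∂μ
      = ∫ ω, V ω * Real.exp (lam * Y ω) ∂μ := by simp only [hexp]
    _ ≤ ∫ ω, (V ω + V ω * Y ω * (Real.exp lam - 1)) ∂μ := by
        refine integral_mono_ae hei hLi ?_
        filter_upwards [hYae] with ω hω
        have := mul_le_mul_of_nonneg_left (exp_mul_le_of_mem_Icc hω lam) (hV0 ω)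
        change V ω * Real.exp (lam * Y ω) ≤ V ω + V ω * Y ω * (Real.exp lam - 1)
        linarith
    _ = ∫ ω, (V ω + V ω * f ω * (Real.exp lam - 1)) ∂μ := by
        rw [integral_add hVi (hYi.mul_const _), integral_add hVi (hfi.mul_const _),
          integral_mul_const, integral_mul_const,
          integral_mul_of_condLaw hm hκ hY hlaw (hmean.mono hm le_rfl) hVm.stronglyMeasurable hVb]
    _ ≤ ∫ ω, W ω ∂μ := by
        refine integral_mono (hVi.add (hfi.mul_const _)) hWi fun ω => ?_
        have h := mul_le_mul_of_nonneg_left (one_add_mul_exp_sub_one_le (hf01 ω) lam) (hV0 ω)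
        have e : V ω * Real.exp (lam * f ω + lam ^ 2 / 8) = W ω := by
          rw [hV, mul_assoc, ← Real.exp_add]; ring_nf; simp
        change V ω + V ω * f ω * (Real.exp lam - 1) ≤ W ω
        linarith

end CondLaw

lemma BanditEnv.mean_mem_Icc {𝒳 : Type*} [MeasurableSpace 𝒳] (M : BanditEnv 𝒳) (x : 𝒳) :
    M.mean x ∈ Set.Icc (0 : ℝ) 1 :=
  HOO.mean_mem_Icc (M.law_unit x)

/-! ### Deviations of the empirical means along a run -/

section Deviation

variable {Ω 𝒳 : Type*}

variable (N : ℕ → Ω → Node) (X : ℕ → Ω → 𝒳) (Y : ℕ → Ω → ℝ)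

/-- The sum of the centered rewards received in the descendants of `v` in the rounds `1, …, n`. -/
noncomputable def centeredSum (f : 𝒳 → ℝ) (v : Node) (n : ℕ) (ω : Ω) : ℝ :=
  ∑ t ∈ visits (fun t => N t ω) v n, (Y t ω - f (X t ω))

/-- The exponential supermartingale of the node `v` with parameter `lam`. -/
noncomputable def expSupermartingale (f : 𝒳 → ℝ) (v : Node) (lam : ℝ) (n : ℕ) (ω : Ω) : ℝ :=
  Real.exp (lam * centeredSum N X Y f v n ω - lam ^ 2 / 8 * count (fun t => N t ω) v n)

variable {N X Y}

/-- Splitting according to whether round `n + 1` visits `v` leaves weights known before the reward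
of that round; only the last exponential involves the new reward. -/
lemma expSupermartingale_succ (f : 𝒳 → ℝ) (v : Node) (lam : ℝ) (n : ℕ) (ω : Ω) :
    expSupermartingale N X Y f v lam (n + 1) ω =
      {w | ¬ IsDescendant v w}.indicator (fun _ => (1 : ℝ)) (N (n + 1) ω)
          * expSupermartingale N X Y f v lam n ω
        + {w | IsDescendant v w}.indicator (fun _ => (1 : ℝ)) (N (n + 1) ω)
          * expSupermartingale N X Y f v lam n ω
          * Real.exp (lam * (Y (n + 1) ω - f (X (n + 1) ω)) - lam ^ 2 / 8) := by
  by_cases h : IsDescendant v (N (n + 1) ω)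
  · have h' : IsDescendant v ((fun t => N t ω) (n + 1)) := h
    simp only [Set.indicator, Set.mem_ofPred_eq, h, not_true, if_true, if_false, zero_mul, zero_add,
      one_mul, expSupermartingale, centeredSum]
    rw [visits_succ_of_isDescendant h', Finset.sum_insert (succ_notMem_visits _ v n),
      count_succ_of_isDescendant h', ← Real.exp_add]
    push_cast
    ring_nf
  · have h' : ¬ IsDescendant v ((fun t => N t ω) (n + 1)) := h
    simp [Set.indicator, h, expSupermartingale, centeredSum, count,
      visits_succ_of_not (N := fun t => N t ω) h']

variable [MeasurableSpace 𝒳]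

variable (N X Y) in
lemma measurable_history_node {s t : ℕ} (h1 : 1 ≤ s) (h2 : s ≤ t) :
    Measurable[history N X Y t] (N s) := by
  rw [measurable_iff_comap_le]
  exact le_trans le_sup_left (le_trans (le_iSup₂ (f := fun s _ =>
    (MeasurableSpace.comap (N s) inferInstance ⊔ MeasurableSpace.comap (X s) inferInstance)) s
    (Finset.mem_Icc.2 ⟨h1, h2⟩)) le_sup_left)

variable (N X Y) in
lemma measurable_history_arm {s t : ℕ} (h1 : 1 ≤ s) (h2 : s ≤ t) :
    Measurable[history N X Y t] (X s) := by
  rw [measurable_iff_comap_le]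
  exact le_trans le_sup_right (le_trans (le_iSup₂ (f := fun s _ =>
    (MeasurableSpace.comap (N s) inferInstance ⊔ MeasurableSpace.comap (X s) inferInstance)) s
    (Finset.mem_Icc.2 ⟨h1, h2⟩)) le_sup_left)

variable (N X Y) in
lemma measurable_history_reward {s t : ℕ} (h1 : 1 ≤ s) (h2 : s < t) :
    Measurable[history N X Y t] (Y s) := by
  rw [measurable_iff_comap_le]
  exact le_trans (le_iSup₂ (f := fun s _ => MeasurableSpace.comap (Y s) inferInstance) s
    (Finset.mem_Ico.2 ⟨h1, h2⟩)) le_sup_right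

variable {M : BanditEnv 𝒳}

lemma measurable_expSupermartingale (hM : Measurable M.mean) (v : Node) (lam : ℝ) (n : ℕ) :
    Measurable[history N X Y (n + 1)] (expSupermartingale N X Y M.mean v lam n) := by
  let m' : MeasurableSpace Ω := history N X Y (n + 1)
  have key : ∀ k ≤ n, Measurable[m'] (expSupermartingale N X Y M.mean v lam k) := by
    intro k hk
    induction k with
    | zero =>
      have : expSupermartingale N X Y M.mean v lam 0 = fun _ => 1 := by
        ext ω; simp [expSupermartingale, centeredSum, count, visits_zero]
      rw [this]; exact measurable_const
    | succ k ih =>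
      have ih := ih (by omega)
      have hN : Measurable[m'] (N (k + 1)) :=
        measurable_history_node N X Y (by omega) (by omega)
      have hX : Measurable[m'] (fun ω => M.mean (X (k + 1) ω)) :=
        hM.comp (measurable_history_arm N X Y (by omega) (by omega))
      have hY : Measurable[m'] (Y (k + 1)) :=
        measurable_history_reward N X Y (by omega) (by omega)
      have hi : ∀ A : Set Node, Measurable[m']
          (fun ω => A.indicator (fun _ => (1 : ℝ)) (N (k + 1) ω)) := fun A =>
        (measurable_of_countable (A.indicator (fun _ => (1 : ℝ)))).comp hN
      rw [show expSupermartingale N X Y M.mean v lam (k + 1) = _ from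
        funext fun ω => expSupermartingale_succ M.mean v lam k ω]
      exact ((hi _).mul ih).add (((hi _).mul ih).mul
        (((hY.sub hX).const_mul lam).sub_const _).exp)
  exact key n le_rfl

variable [MeasurableSpace Ω] {P : ℕ → ℕ → Set 𝒳} {ν₁ ρ : ℝ} {n₀ : ℕ}
  {μ : Measure Ω}

lemma IsTruncatedHOORun.history_le (h : IsTruncatedHOORun M P ν₁ ρ n₀ μ N X Y) {t : ℕ}
    (ht : t ≤ n₀) : history N X Y t ≤ ‹MeasurableSpace Ω› := by
  refine sup_le (iSup₂_le fun s hs => ?_) (iSup₂_le fun s hs => ?_)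
  · have hs := Finset.mem_Icc.1 hs
    exact sup_le (h.measurable_node s hs.1 (by omega)).comap_le
      (h.measurable_arm s hs.1 (by omega)).comap_le
  · have hs := Finset.mem_Ico.1 hs
    exact (h.measurable_reward s hs.1 (by omega)).comap_le

variable [IsProbabilityMeasure μ]

lemma IsTruncatedHOORun.reward_mem (h : IsTruncatedHOORun M P ν₁ ρ n₀ μ N X Y) {t : ℕ}
    (ht1 : 1 ≤ t) (ht : t ≤ n₀) : ∀ᵐ ω ∂μ, Y t ω ∈ Set.Icc (0 : ℝ) 1 :=
  ae_mem_Icc_of_condLaw (h.history_le ht) (κ := fun ω => (M.law (X t ω) : Measure ℝ))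
    (fun _ => M.law_unit _) (h.measurable_reward t ht1 ht) (h.reward_law t ht1 ht)

lemma IsTruncatedHOORun.expSupermartingale_le (h : IsTruncatedHOORun M P ν₁ ρ n₀ μ N X Y) (v : Node)
    (lam : ℝ) {n : ℕ} (hn : n ≤ n₀) :
    ∀ᵐ ω ∂μ, expSupermartingale N X Y M.mean v lam n ω ≤ Real.exp (n * |lam|) := by
  have hae : ∀ᵐ ω ∂μ, ∀ t ∈ Finset.Icc 1 n, Y t ω ∈ Set.Icc (0 : ℝ) 1 := by
    rw [Finset.eventually_all]
    intro t ht
    have ht := Finset.mem_Icc.1 ht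
    exact h.reward_mem ht.1 (by omega)
  filter_upwards [hae] with ω hω
  refine Real.exp_le_exp.2 ?_
  have h1 : |centeredSum N X Y M.mean v n ω| ≤ n := by
    calc _ ≤ ∑ t ∈ visits (fun t => N t ω) v n, |Y t ω - M.mean (X t ω)| :=
          Finset.abs_sum_le_sum_abs _ _
      _ ≤ ∑ t ∈ visits (fun t => N t ω) v n, (1 : ℝ) := by
          refine Finset.sum_le_sum fun t ht => ?_
          have hy := hω t (Finset.mem_Icc.2 (mem_visits.1 ht).1)
          have hf := M.mean_mem_Icc (X t ω)
          rw [abs_le]; constructor <;> linarith [hy.1, hy.2, hf.1, hf.2]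
      _ ≤ ∑ t ∈ Finset.Icc 1 n, (1 : ℝ) :=
          Finset.sum_le_sum_of_subset_of_nonneg
            (fun t ht => Finset.mem_Icc.2 (mem_visits.1 ht).1) fun _ _ _ => zero_le_one
      _ = n := by simp
  have h2 : lam * centeredSum N X Y M.mean v n ω ≤ n * |lam| := by
    calc _ ≤ |lam * centeredSum N X Y M.mean v n ω| := le_abs_self _
      _ = |centeredSum N X Y M.mean v n ω| * |lam| := by rw [abs_mul, mul_comm]
      _ ≤ _ := by gcongr
  have h3 : 0 ≤ lam ^ 2 / 8 * count (fun t => N t ω) v n := by positivity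
  linarith

/-- The weighted conditional Hoeffding inequality shows that a visit to `v` does not increase the
expectation; a round without a visit leaves the process unchanged. -/
lemma IsTruncatedHOORun.integral_expSupermartingale_le (h : IsTruncatedHOORun M P ν₁ ρ n₀ μ N X Y)
    (v : Node) (lam : ℝ) {n : ℕ} (hn : n ≤ n₀) :
    Integrable (expSupermartingale N X Y M.mean v lam n) μ ∧
      ∫ ω, expSupermartingale N X Y M.mean v lam n ω ∂μ ≤ 1 := by
  induction n with
  | zero =>
    have : expSupermartingale N X Y M.mean v lam 0 = fun _ => 1 := by
      ext ω; simp [expSupermartingale, centeredSum, count, visits_zero]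
    rw [this]; exact ⟨integrable_const _, by simp⟩
  | succ n ih =>
    obtain ⟨ih1, ih2⟩ := ih (by omega)
    have hm := h.history_le hn
    have hNm := measurable_history_node N X Y (s := n + 1) (t := n + 1) (by omega) le_rfl
    have hXm := measurable_history_arm N X Y (s := n + 1) (t := n + 1) (by omega) le_rfl
    have hYm := h.measurable_reward (n + 1) (by omega) hn
    have hZm := measurable_expSupermartingale (N := N) (X := X) (Y := Y) M.measurable_mean v lam n
    have hi : ∀ A : Set Node, Measurable[history N X Y (n + 1)]
        (fun ω => A.indicator (fun _ => (1 : ℝ)) (N (n + 1) ω)) := fun A =>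
      (measurable_of_countable (A.indicator (fun _ => (1 : ℝ)))).comp hNm
    have hb : ∀ (A : Set Node) (w : Node), ‖A.indicator (fun _ => (1 : ℝ)) w‖ ≤ 1 := fun A w => by
      by_cases hw : w ∈ A <;> simp [hw]
    have hI : ∀ A : Set Node, Integrable (fun ω => A.indicator (fun _ => (1 : ℝ)) (N (n + 1) ω)
        * expSupermartingale N X Y M.mean v lam n ω) μ := fun A =>
      ih1.bdd_mul ((hi A).mono hm le_rfl).aestronglyMeasurable (ae_of_all _ fun ω => hb A _)
    set W : Ω → ℝ := fun ω => {w | IsDescendant v w}.indicator (fun _ => (1 : ℝ)) (N (n + 1) ω)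
        * expSupermartingale N X Y M.mean v lam n ω with hW
    have hW0 : ∀ ω, 0 ≤ W ω := fun ω => mul_nonneg
      (Set.indicator_nonneg (fun _ _ => zero_le_one) _) (Real.exp_nonneg _)
    have hWC : ∀ᵐ ω ∂μ, |W ω| ≤ Real.exp (n * |lam|) := by
      filter_upwards [h.expSupermartingale_le v lam (by omega : n ≤ n₀)] with ω hω
      rw [hW, abs_mul]
      calc _ ≤ 1 * |expSupermartingale N X Y M.mean v lam n ω| := by
            gcongr; exact hb _ _
        _ ≤ _ := by rwa [one_mul, expSupermartingale, Real.abs_exp]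
    have hmain := integral_mul_exp_of_condLaw hm (κ := fun ω => (M.law (X (n + 1) ω) : Measure ℝ))
      (fun _ => M.law_unit _) hYm (h.reward_law (n + 1) (by omega) hn)
      (M.measurable_mean.comp hXm) ((hi {w | IsDescendant v w}).mul hZm) hW0 hWC lam
    have hE : Integrable (fun ω => W ω *
        Real.exp (lam * (Y (n + 1) ω - M.mean (X (n + 1) ω)) - lam ^ 2 / 8)) μ := by
      refine Integrable.of_bound (C := Real.exp (n * |lam|) * Real.exp |lam|)
        ((hI _).aestronglyMeasurable.mul ((((hYm.sub (M.measurable_mean.comp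
          (hXm.mono hm le_rfl))).const_mul lam).sub_const _).exp).aestronglyMeasurable) ?_
      filter_upwards [hWC, h.reward_mem (by omega) hn] with ω h1 h2
      rw [norm_mul]
      refine mul_le_mul h1 ?_ (norm_nonneg _) (Real.exp_nonneg _)
      rw [Real.norm_eq_abs, Real.abs_exp, Real.exp_le_exp]
      have hf := M.mean_mem_Icc (X (n + 1) ω)
      have : |Y (n + 1) ω - M.mean (X (n + 1) ω)| ≤ 1 := by
        rw [abs_le]; constructor <;> linarith [h2.1, h2.2, hf.1, hf.2]
      have h3 : lam * (Y (n + 1) ω - M.mean (X (n + 1) ω)) ≤ |lam| := by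
        calc _ ≤ |lam * (Y (n + 1) ω - M.mean (X (n + 1) ω))| := le_abs_self _
          _ ≤ _ := by rw [abs_mul]; exact mul_le_of_le_one_right (abs_nonneg _) this
      nlinarith [sq_nonneg lam]
    have heq : expSupermartingale N X Y M.mean v lam (n + 1) = fun ω =>
        {w | ¬ IsDescendant v w}.indicator (fun _ => (1 : ℝ)) (N (n + 1) ω)
          * expSupermartingale N X Y M.mean v lam n ω
        + W ω * Real.exp (lam * (Y (n + 1) ω - M.mean (X (n + 1) ω)) - lam ^ 2 / 8) :=
      funext fun ω => expSupermartingale_succ M.mean v lam n ω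
    rw [heq]
    refine ⟨(hI _).add hE, ?_⟩
    rw [integral_add (hI _) hE]
    refine le_trans (add_le_add_right hmain _) ?_
    rw [show (∫ ω, ((fun ω => {w | IsDescendant v w}.indicator (fun _ => (1 : ℝ)) (N (n + 1) ω)) *
      expSupermartingale N X Y M.mean v lam n) ω ∂μ) = ∫ ω, W ω ∂μ from rfl,
      ← integral_add (hI _) (hI _)]
    refine le_trans (le_of_eq (integral_congr_ae (ae_of_all _ fun ω => ?_))) ih2
    by_cases hd : IsDescendant v (N (n + 1) ω) <;> simp [Set.indicator, hd]

/-- The event that some empirical mean of `v` leaves its confidence interval. -/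
def deviationEvent (f : 𝒳 → ℝ) (n₀ : ℕ) (N : ℕ → Ω → Node) (X : ℕ → Ω → 𝒳) (Y : ℕ → Ω → ℝ)
    (v : Node) : Set Ω :=
  {ω | ∃ n ≤ n₀, 0 < count (fun t => N t ω) v n ∧
    Real.sqrt (2 * Real.log n₀ / count (fun t => N t ω) v n) * count (fun t => N t ω) v n
      ≤ |centeredSum N X Y f v n ω|}

lemma count_le (N : ℕ → Node) (v : Node) (n : ℕ) : count N v n ≤ n := by
  calc count N v n ≤ (Finset.Icc 1 n).card := Finset.card_le_card fun t ht =>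
        Finset.mem_Icc.2 (mem_visits.1 ht).1
    _ = n := by simp

/-- The best parameter depends on the random number of visits, so the union bound runs over pairs
(round, number of visits). With two signs, at most `n₀²` pairs and Markov's bound `n₀^(-4)` for
each, the total is `2 / n₀²`. -/
lemma IsTruncatedHOORun.measureReal_deviationEvent_le
    (h : IsTruncatedHOORun M P ν₁ ρ n₀ μ N X Y) (hn₀ : 1 ≤ n₀) (v : Node) :
    μ.real (deviationEvent M.mean n₀ N X Y v) ≤ 2 / (n₀ : ℝ) ^ 2 := by
  have hn : (0 : ℝ) < n₀ := by exact_mod_cast hn₀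
  have hL : 0 ≤ Real.log n₀ := Real.log_natCast_nonneg _
  -- With `a = √(2 ln n₀ / s)` and a deviation `a s`, the value `4a` maximizes `lam * a * s - lam ^
  -- 2 * s / 8`; the maximum is `2 a² s = 4 ln n₀`.
  set lam : ℕ → ℝ := fun s => 4 * Real.sqrt (2 * Real.log n₀ / s) with hlam
  set A : ℝ → ℕ → Set Ω := fun l n => {ω | (n₀ : ℝ) ^ 4 ≤ expSupermartingale N X Y M.mean v l n ω}
    with hA
  have hAle : ∀ l, ∀ n ≤ n₀, μ.real (A l n) ≤ 1 / (n₀ : ℝ) ^ 4 := by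
    intro l n hnn
    obtain ⟨h1, h2⟩ := h.integral_expSupermartingale_le v l hnn
    have h3 := mul_meas_ge_le_integral_of_nonneg
      (ae_of_all _ fun ω => Real.exp_nonneg _) h1 ((n₀ : ℝ) ^ 4)
    rw [le_div_iff₀ (by positivity), mul_comm]
    exact h3.trans h2
  have hsub : deviationEvent M.mean n₀ N X Y v ⊆
      ⋃ p ∈ Finset.Icc 1 n₀ ×ˢ Finset.Icc 1 n₀, (A (lam p.2) p.1 ∪ A (-lam p.2) p.1) := by
    rintro ω ⟨n, hnn, hpos, hdev⟩
    set s := count (fun t => N t ω) v n with hs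
    have hsn : s ≤ n := count_le _ _ _
    have hs0 : (0 : ℝ) < s := by exact_mod_cast hpos
    refine Set.mem_biUnion (x := (n, s)) ?_ ?_
    · simp only [Finset.coe_product, Finset.coe_Icc, Set.mem_prod, Set.mem_Icc]
      omega
    set a := Real.sqrt (2 * Real.log n₀ / s) with ha
    have ha0 : 0 ≤ a := Real.sqrt_nonneg _
    have ha2 : a ^ 2 * s = 2 * Real.log n₀ := by
      rw [ha, Real.sq_sqrt (by positivity)]; field_simp
    have hexp : (n₀ : ℝ) ^ 4 = Real.exp (4 * Real.log n₀) := by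
      rw [mul_comm, Real.exp_mul, Real.exp_log hn]; norm_cast
    have key : ∀ l S : ℝ, l ^ 2 = 16 * a ^ 2 → 4 * a * (a * s) ≤ l * S →
        4 * Real.log n₀ ≤ l * S - l ^ 2 / 8 * s := by
      intro l S h1 h2
      rw [h1]
      nlinarith
    rcases le_abs.1 hdev with hd | hd
    · left
      simp only [hA, Set.mem_ofPred_eq, expSupermartingale, hexp, Real.exp_le_exp]
      refine key _ _ (by simp only [hlam, ← ha]; ring) ?_
      simp only [hlam, ← ha]
      gcongr
    · right
      simp only [hA, Set.mem_ofPred_eq, expSupermartingale, hexp, Real.exp_le_exp]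
      refine key _ _ (by simp only [hlam, ← ha]; ring) ?_
      simp only [hlam, ← ha]
      rw [neg_mul_comm]
      gcongr
  calc μ.real (deviationEvent M.mean n₀ N X Y v) ≤ _ :=
        measureReal_mono hsub (measure_ne_top _ _)
    _ ≤ ∑ p ∈ Finset.Icc 1 n₀ ×ˢ Finset.Icc 1 n₀, μ.real (A (lam p.2) p.1 ∪ A (-lam p.2) p.1) :=
        measureReal_biUnion_finset_le _ _
    _ ≤ ∑ p ∈ Finset.Icc 1 n₀ ×ˢ Finset.Icc 1 n₀, 2 / (n₀ : ℝ) ^ 4 := by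
        refine Finset.sum_le_sum fun p hp => ?_
        have hp1 := (Finset.mem_Icc.1 (Finset.mem_product.1 hp).1).2
        calc _ ≤ _ := measureReal_union_le _ _
          _ ≤ 1 / (n₀ : ℝ) ^ 4 + 1 / (n₀ : ℝ) ^ 4 := add_le_add (hAle _ _ hp1) (hAle _ _ hp1)
          _ = _ := by ring
    _ = _ := by
        simp only [Finset.sum_const, Finset.card_product, Nat.card_Icc, Nat.add_sub_cancel,
          nsmul_eq_mul]
        push_cast
        field_simp

end Deviation

/-! ### Gaps inside the regions, and the path of optimal nodes -/

section Regions

variable {𝒳 : Type*} {P : ℕ → ℕ → Set 𝒳} {ν₁ ρ ν₂ : ℝ} {ℓ : 𝒳 → 𝒳 → ℝ}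
  {f : 𝒳 → ℝ}

lemma IsDescendant.le_two_pow {v : Node} (hv : IsDescendant root v) : v.2 ≤ 2 ^ v.1 := by
  obtain ⟨k, h1, -, h3⟩ := hv.bounds (by simp [root])
  simp only [root, zero_add, mul_one] at h1 h3
  rwa [h1]

lemma Shrinking.dissim_le (h : Shrinking P ℓ ν₁ ρ ν₂) {v : Node} (hv : IsDescendant root v)
    {x y : 𝒳} (hx : x ∈ P v.1 v.2) (hy : y ∈ P v.1 v.2) : ℓ x y ≤ ν₁ * ρ ^ v.1 := by
  have h1 := h.diam_le v.1 v.2 (hv.one_le (by simp [root])) hv.le_two_pow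
  rw [← EReal.coe_le_coe_iff]
  refine le_trans ?_ h1
  unfold diam
  exact le_trans (le_iSup₂ (f := fun y (_ : y ∈ P v.1 v.2) => (ℓ x y : EReal)) y hy)
    (le_iSup₂ (f := fun x (_ : x ∈ P v.1 v.2) => ⨆ y ∈ P v.1 v.2, (ℓ x y : EReal)) x hx)

/-- All arms in the region of the node are nearly optimal, at the scale of its depth. -/
def NearOptimalNode (P : ℕ → ℕ → Set 𝒳) (f : 𝒳 → ℝ) (ν₁ ρ : ℝ) (v : Node) : Prop :=
  ∀ x ∈ P v.1 v.2, best f - f x ≤ 4 * ν₁ * ρ ^ v.1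

/-- One arm with gap at most `2ν₁ρ^h` would, by the weak Lipschitz property, bound all gaps in the
region by `2ν₁ρ^h + max (2ν₁ρ^h) (ν₁ρ^h) = 4ν₁ρ^h`. -/
lemma gap_gt_of_not_nearOptimalNode (hℓ : IsDissimilarity ℓ) (hA1 : Shrinking P ℓ ν₁ ρ ν₂)
    (hA2 : WeaklyLipschitz ℓ f) {v : Node} (hv : IsDescendant root v)
    (hnear : ¬ NearOptimalNode P f ν₁ ρ v) {y : 𝒳}
    (hy : y ∈ P v.1 v.2) : 2 * (ν₁ * ρ ^ v.1) < best f - f y := by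
  by_contra! hle
  refine hnear fun x hx => ?_
  have h1 := hA2 y x
  have h2 := hA1.dissim_le hv hy hx
  have h3 := hℓ.nonneg y x
  rcases max_cases (best f - f y) (ℓ y x) with h | h <;> linarith

/-- The payoffs in the region of the node come arbitrarily close to the best one. -/
def OptimalNode (P : ℕ → ℕ → Set 𝒳) (f : 𝒳 → ℝ) (v : Node) : Prop :=
  ∀ δ > 0, ∃ x ∈ P v.1 v.2, best f - δ < f x

/-- The best payoff need not be attained, so the Lipschitz property is applied from an arm of gap
below `δ / 2`, and `δ` is arbitrary. -/
lemma gap_le_of_optimalNode (hℓ : IsDissimilarity ℓ) (hA1 : Shrinking P ℓ ν₁ ρ ν₂)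
    (hA2 : WeaklyLipschitz ℓ f) {v : Node} (hv : IsDescendant root v)
    (hopt : OptimalNode P f v) {x : 𝒳}
    (hx : x ∈ P v.1 v.2) (hf : ∀ x, f x ≤ best f) : best f - f x ≤ ν₁ * ρ ^ v.1 := by
  refine le_of_forall_pos_le_add fun δ hδ => ?_
  obtain ⟨z, hz, hzδ⟩ := hopt (δ / 2) (by positivity)
  have h1 := hA2 z x
  have h2 := hA1.dissim_le hv hz hx
  have h3 := hf z
  have h4 := hf x
  rcases max_cases (best f - f z) (ℓ z x) with h | h
  · have := (hℓ.nonneg z x).trans h2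
    linarith
  · linarith

variable [MeasurableSpace 𝒳]

lemma IsTreeOfCoverings.subset (hP : IsTreeOfCoverings P) {v w : Node} (hv : IsDescendant root v)
    (h : IsDescendant v w) : P w.1 w.2 ⊆ P v.1 v.2 := by
  induction h with
  | refl => exact le_rfl
  | tail hvb hbc ih =>
    rename_i b c
    have hb := hv.trans hvb
    refine Set.Subset.trans ?_ ih
    rw [hP.union_eq b.1 b.2 (hb.one_le (by simp [root])) hb.le_two_pow]
    rcases hbc with rfl | rfl
    · exact Set.subset_union_left
    · exact Set.subset_union_right

lemma optimalNode_root [Nonempty 𝒳] (hP : IsTreeOfCoverings P) : OptimalNode P f root := by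
  intro δ hδ
  obtain ⟨x, hx⟩ := exists_lt_of_lt_ciSup (show best f - δ < ⨆ x, f x by
    change best f - δ < best f; linarith)
  exact ⟨x, by simp [root, hP.root_eq], hx⟩

lemma OptimalNode.child (hP : IsTreeOfCoverings P) {v : Node} (hv : IsDescendant root v)
    (h : OptimalNode P f v) : OptimalNode P f (child₁ v) ∨ OptimalNode P f (child₂ v) := by
  by_contra! hne
  simp only [OptimalNode, not_forall, not_exists, not_and, not_lt, exists_prop] at hne
  obtain ⟨⟨δ₁, h1, h1'⟩, ⟨δ₂, h2, h2'⟩⟩ := hne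
  obtain ⟨x, hx, hxδ⟩ := h (min δ₁ δ₂) (lt_min h1 h2)
  rw [hP.union_eq v.1 v.2 (hv.one_le (by simp [root])) hv.le_two_pow] at hx
  rcases hx with hx | hx
  · linarith [h1' x hx, min_le_left δ₁ δ₂]
  · linarith [h2' x hx, min_le_right δ₁ δ₂]

/-- There is an infinite path of optimal nodes starting at the root. -/
lemma exists_optimal_path [Nonempty 𝒳] (hP : IsTreeOfCoverings P) (f : 𝒳 → ℝ) :
    ∃ p : ℕ → Node, p 0 = root ∧ (∀ s, p (s + 1) = child₁ (p s) ∨ p (s + 1) = child₂ (p s)) ∧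
      ∀ s, (p s).1 = s ∧ IsDescendant root (p s) ∧ OptimalNode P f (p s) := by
  have hstep : ∀ v : {v : Node // IsDescendant root v ∧ OptimalNode P f v},
      ∃ w : {v : Node // IsDescendant root v ∧ OptimalNode P f v},
        w.1 = child₁ v.1 ∨ w.1 = child₂ v.1 := by
    rintro ⟨v, hv, hopt⟩
    rcases hopt.child hP hv with h | h
    · exact ⟨⟨_, hv.trans (isDescendant_child₁ v), h⟩, Or.inl rfl⟩
    · exact ⟨⟨_, hv.trans (isDescendant_child₂ v), h⟩, Or.inr rfl⟩
  choose g hg using hstep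
  let q : ℕ → {v : Node // IsDescendant root v ∧ OptimalNode P f v} := fun s =>
    g^[s] ⟨root, IsDescendant.refl _, optimalNode_root hP⟩
  have hq : ∀ s, (q (s + 1)).1 = child₁ (q s).1 ∨ (q (s + 1)).1 = child₂ (q s).1 := by
    intro s
    have : q (s + 1) = g (q s) := Function.iterate_succ_apply' g s _
    rw [this]; exact hg _
  refine ⟨fun s => (q s).1, rfl, hq, fun s => ⟨?_, (q s).2⟩⟩
  induction s with
  | zero => rfl
  | succ s ih => rcases hq s with h | h <;> simp only [h, child₁, child₂, ih]

end Regions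

/-! ### Consequences of the confidence bounds -/

section Confidence

variable {𝒳 : Type*} {f : 𝒳 → ℝ} {ν₁ ρ : ℝ} {n₀ : ℕ} {N : ℕ → Node} {x : ℕ → 𝒳} {y : ℕ → ℝ}
  {n : ℕ} {v : Node}

/-- Optimism: the confidence radius covers the noise, and `ν₁ρ^h` covers the gaps of the arms
played. -/
lemma best_le_UValue {b : ℝ} (hdev : 0 < count N v n →
      |∑ t ∈ visits N v n, (y t - f (x t))|
        < Real.sqrt (2 * Real.log n₀ / count N v n) * count N v n)
    (hgap : ∀ t ∈ visits N v n, b - f (x t) ≤ ν₁ * ρ ^ v.1) :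
    (b : EReal) ≤ UValue ν₁ ρ n₀ N y n v := by
  unfold UValue
  split_ifs with h
  · rw [EReal.coe_le_coe_iff]
    have hT : (0 : ℝ) < count N v n := by exact_mod_cast h
    have hdev := (abs_lt.1 (hdev h)).1
    have hsum := Finset.sum_le_sum hgap
    rw [Finset.sum_sub_distrib, Finset.sum_const, Finset.sum_const, nsmul_eq_mul,
      nsmul_eq_mul] at hsum
    rw [Finset.sum_sub_distrib] at hdev
    change (count N v n : ℝ) * b - _ ≤ (count N v n : ℝ) * _ at hsum
    set a := Real.sqrt (2 * Real.log n₀ / count N v n)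
    have hm : empMean N y v n * count N v n = ∑ t ∈ visits N v n, y t := by
      unfold empMean; field_simp
    refine le_of_mul_le_mul_right ?_ hT
    rw [add_mul, add_mul, hm]
    linarith
  · exact le_top

/-- The count is chosen so that the confidence radius is at most `ν₁ρ^h / 2`. The noise, the radius
in `U` and the term `ν₁ρ^h` then add up to less than the gap `2ν₁ρ^h`. -/
lemma UValue_lt_best {b : ℝ} (hpos : 0 < count N v n) (hd : 0 < ν₁ * ρ ^ v.1)
    (hcount : 8 * Real.log n₀ / (ν₁ * ρ ^ v.1) ^ 2 ≤ count N v n)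
    (hdev : |∑ t ∈ visits N v n, (y t - f (x t))|
        < Real.sqrt (2 * Real.log n₀ / count N v n) * count N v n)
    (hgap : ∀ t ∈ visits N v n, 2 * (ν₁ * ρ ^ v.1) ≤ b - f (x t)) :
    UValue ν₁ ρ n₀ N y n v < (b : EReal) := by
  rw [UValue, if_pos hpos, EReal.coe_lt_coe_iff]
  have hT : (0 : ℝ) < count N v n := by exact_mod_cast hpos
  have hdev := (abs_lt.1 hdev).2
  have hsum := Finset.sum_le_sum hgap
  rw [Finset.sum_sub_distrib, Finset.sum_const, Finset.sum_const, nsmul_eq_mul,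
    nsmul_eq_mul] at hsum
  rw [Finset.sum_sub_distrib] at hdev
  change (count N v n : ℝ) * _ ≤ (count N v n : ℝ) * b - _ at hsum
  have ha : Real.sqrt (2 * Real.log n₀ / count N v n) ≤ ν₁ * ρ ^ v.1 / 2 := by
    rw [Real.sqrt_le_left (by positivity), div_le_iff₀ hT]
    rw [div_le_iff₀ (by positivity)] at hcount
    nlinarith
  set a := Real.sqrt (2 * Real.log n₀ / count N v n)
  have hm : empMean N y v n * count N v n = ∑ t ∈ visits N v n, y t := by
    unfold empMean; field_simp
  refine lt_of_mul_lt_mul_right ?_ hT.le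
  rw [add_mul, add_mul, hm]
  nlinarith

lemma le_BAux_of_path {b : EReal} {p : ℕ → Node}
    (hp : ∀ s, p (s + 1) = child₁ (p s) ∨ p (s + 1) = child₂ (p s))
    (hU : ∀ s ≤ truncDepth ν₁ ρ n₀, b ≤ UValue ν₁ ρ n₀ N y n (p s)) {k s : ℕ}
    (hk : s + k = truncDepth ν₁ ρ n₀) : b ≤ BAux ν₁ ρ n₀ N y n k (p s) := by
  induction k generalizing s with
  | zero =>
    unfold BAux
    split_ifs
    · exact hU s (by omega)
    · exact le_top
  | succ k ih =>
    unfold BAux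
    split_ifs
    · refine le_min (hU s (by omega)) ?_
      have := ih (s := s + 1) (by omega)
      rcases hp s with h | h <;> rw [h] at this
      · exact this.trans (le_max_left _ _)
      · exact this.trans (le_max_right _ _)
    · exact le_top

/-- The `B`-value of a traversed node is at most the larger one of its children, and the descent
goes to that child. -/
lemma le_BValue_of_greedy {b : EReal} {v w : Node} (hb : b ≤ BValue ν₁ ρ n₀ N y n v)
    (h : Relation.ReflTransGen (GreedyStep ν₁ ρ n₀ N y n) v w) :
    b ≤ BValue ν₁ ρ n₀ N y n w := by
  induction h with
  | refl => exact hb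
  | @tail u w _ hbc ih =>
    obtain ⟨hu, hlt, hw⟩ := hbc
    obtain ⟨k, hk⟩ : ∃ k, u.1 + (k + 1) = truncDepth ν₁ ρ n₀ :=
      ⟨truncDepth ν₁ ρ n₀ - u.1 - 1, by omega⟩
    have k1 : (child₁ u).1 + k = truncDepth ν₁ ρ n₀ := by simp only [child₁]; omega
    have k2 : (child₂ u).1 + k = truncDepth ν₁ ρ n₀ := by simp only [child₂]; omega
    rw [BValue_eq_BAux k1, BValue_eq_BAux k2] at hw
    rw [BValue_eq_BAux hk, BAux, if_pos hu] at ih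
    have ih := ih.trans (min_le_right _ _)
    rcases hw with ⟨rfl, hle⟩ | ⟨rfl, hle⟩
    · rw [BValue_eq_BAux k1]; rwa [max_eq_left hle] at ih
    · rw [BValue_eq_BAux k2]; rwa [max_eq_right hle] at ih

lemma BAux_le_UValue {k : ℕ} (h : v ∈ tree N n) :
    BAux ν₁ ρ n₀ N y n k v ≤ UValue ν₁ ρ n₀ N y n v := by
  cases k with
  | zero => rw [BAux, if_pos h]
  | succ k => rw [BAux, if_pos h]; exact min_le_left _ _

/-- As long as the confidence bounds hold, a suboptimal node is visited only a logarithmic number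
of times. -/
lemma count_le_of_confidence {b u : ℝ} {p : ℕ → Node} (hu : 0 ≤ u)
    (hHOO : IsTruncatedHOO ν₁ ρ n₀ N y) (hp0 : p 0 = root)
    (hp : ∀ s, p (s + 1) = child₁ (p s) ∨ p (s + 1) = child₂ (p s))
    (hpU : ∀ n ≤ n₀, ∀ s ≤ truncDepth ν₁ ρ n₀, (b : EReal) ≤ UValue ν₁ ρ n₀ N y n (p s))
    (hv : IsDescendant root v)
    (hvU : ∀ n ≤ n₀, 0 < count N v n → u ≤ count N v n → UValue ν₁ ρ n₀ N y n v < (b : EReal))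
    (hn : n ≤ n₀) : (count N v n : ℝ) ≤ u + 1 := by
  induction n with
  | zero => simp [count, visits_zero]; linarith
  | succ n ih =>
    have ih := ih (by omega)
    by_cases hd : IsDescendant v (N (n + 1))
    · rw [count_succ_of_isDescendant hd]
      push_cast
      -- Otherwise `v` had more than `u` visits before this round, so its `U`-value was below `b`;
      -- but `v` is on the greedy path, where `B` is at least `b`. The `+ 1` is the current visit.
      by_contra! hlt
      have hpos : 0 < count N v n := by
        rcases Nat.eq_zero_or_pos (count N v n) with h0 | h0
        · rw [h0] at hlt; simp at hlt; linarith
        · exact h0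
      have hUv := hvU n (by omega) hpos (by linarith)
      have hgreedy := (hHOO (n + 1) (by omega) hn).1
      rw [Nat.add_sub_cancel] at hgreedy
      obtain ⟨hgv, -⟩ := mem_tree_or_eq_of_greedy (by simp [root]) hgreedy hv hd
      have hvt : v ∈ tree N n := by
        obtain ⟨t, ⟨h1, h2⟩, h3⟩ := count_pos.1 hpos
        exact ancestorClosed_of_selectable (fun t h1 h2 => hHOO t h1 (by omega)) t h1 h2 v hv h3
      have hroot : (b : EReal) ≤ BValue ν₁ ρ n₀ N y n root := by
        rw [BValue_eq_BAux (k := truncDepth ν₁ ρ n₀) (by simp [root]), ← hp0]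
        exact le_BAux_of_path hp (hpU n (by omega)) (by simp)
      have hB := le_BValue_of_greedy hroot hgv
      exact absurd (hB.trans (BAux_le_UValue hvt)) (not_le.2 hUv)
    · rwa [count, visits_succ_of_not hd]

end Confidence

/-! ### Decomposition of the regret -/

section Decomposition

/-- On the way from the root to `w`, either `Q` is first lost within depth `H`, or depth `H` is
reached inside `Q`, or the path ends before. -/
lemma node_trichotomy (Q : Node → Prop) (hroot : Q root) (H : ℕ) {w : Node}
    (hw : IsDescendant root w) :
    (∃ v c, IsDescendant root v ∧ Q v ∧ v.1 < H ∧ (c = child₁ v ∨ c = child₂ v) ∧ ¬ Q c ∧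
      IsDescendant c w) ∨
    (∃ v, IsDescendant root v ∧ Q v ∧ v.1 = H ∧ IsDescendant v w) ∨ (Q w ∧ w.1 < H) := by
  induction hw with
  | refl =>
    rcases Nat.eq_zero_or_pos H with rfl | hH
    · exact Or.inr (Or.inl ⟨root, .refl _, hroot, rfl, .refl _⟩)
    · exact Or.inr (Or.inr ⟨hroot, hH⟩)
  | tail hb hbc ih =>
    rename_i u w
    have huw : IsDescendant u w := Relation.ReflTransGen.single hbc
    rcases ih with ⟨v, c, h1, h2, h3, h4, h5, h6⟩ | ⟨v, h1, h2, h3, h4⟩ | ⟨h1, h2⟩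
    · exact Or.inl ⟨v, c, h1, h2, h3, h4, h5, h6.trans huw⟩
    · exact Or.inr (Or.inl ⟨v, h1, h2, h3, h4.trans huw⟩)
    · have hd : w.1 = u.1 + 1 := by rcases hbc with rfl | rfl <;> rfl
      by_cases hQ : Q w
      · rcases Nat.lt_or_ge w.1 H with h | h
        · exact Or.inr (Or.inr ⟨hQ, h⟩)
        · exact Or.inr (Or.inl ⟨w, Relation.ReflTransGen.tail hb hbc, hQ, by omega, .refl _⟩)
      · exact Or.inl ⟨u, w, hb, h1, h2, hbc, hQ, .refl _⟩

variable {𝒳 : Type*} {P : ℕ → ℕ → Set 𝒳} {ν₁ ρ : ℝ} {f : 𝒳 → ℝ} {n₀ : ℕ}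
  {N : ℕ → Node} {x : ℕ → 𝒳} {y : ℕ → ℝ}

open Classical in
/-- The indices of the near-optimal nodes of depth `h`. -/
noncomputable def nearIndices (P : ℕ → ℕ → Set 𝒳) (f : 𝒳 → ℝ) (ν₁ ρ : ℝ) (h : ℕ) : Finset ℕ :=
  {i ∈ Finset.Icc 1 (2 ^ h) | NearOptimalNode P f ν₁ ρ (h, i)}

lemma mem_nearIndices {h i : ℕ} : i ∈ nearIndices P f ν₁ ρ h ↔
    (1 ≤ i ∧ i ≤ 2 ^ h) ∧ NearOptimalNode P f ν₁ ρ (h, i) := by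
  simp [nearIndices]

open Classical in
/-- The number of visits to a node, `0` for a near-optimal node. -/
noncomputable def suboptimalCount (P : ℕ → ℕ → Set 𝒳) (f : 𝒳 → ℝ) (ν₁ ρ : ℝ) (N : ℕ → Node)
    (n : ℕ) (v : Node) : ℝ :=
  if NearOptimalNode P f ν₁ ρ v then 0 else count N v n

/-- Above the truncation depth only nodes outside the tree are played, and a play puts the node into
the tree. -/
lemma play_unique (hHOO : IsTruncatedHOO ν₁ ρ n₀ N y) {v : Node}
    (hv : v.1 < truncDepth ν₁ ρ n₀) {s t : ℕ} (hs : 1 ≤ s) (hst : s < t) (ht : t ≤ n₀)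
    (h1 : N s = v) (h2 : N t = v) : False := by
  rcases (hHOO t (by omega) ht).2 with h | h
  · exact h (Or.inr ⟨s, hs, by omega, by rw [h1, h2]⟩)
  · rw [h2] at h; omega

open Classical in
lemma card_plays_le_one (hHOO : IsTruncatedHOO ν₁ ρ n₀ N y) {v : Node}
    (hv : v.1 < truncDepth ν₁ ρ n₀) : ((Finset.Icc 1 n₀).filter fun t => N t = v).card ≤ 1 := by
  rw [Finset.card_le_one]
  intro s hs t ht
  simp only [Finset.mem_filter, Finset.mem_Icc] at hs ht
  rcases lt_trichotomy s t with h | h | h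
  · exact (play_unique hHOO hv hs.1.1 h ht.1.2 hs.2 ht.2).elim
  · exact h
  · exact (play_unique hHOO hv ht.1.1 h hs.1.2 ht.2 hs.2).elim

variable [MeasurableSpace 𝒳]

open Classical in
-- The trichotomy, applied to near-optimality, supplies a near-optimal ancestor of `w`, whose region
-- contains `z`. It pays for the gap: through the first term if its depth is `H`, otherwise through
-- one of its three indicators.
lemma gap_le_sum (hP : IsTreeOfCoverings P) (hν₁ : 0 < ν₁) (hρ₀ : 0 < ρ)
    (hroot : NearOptimalNode P f ν₁ ρ root) (H : ℕ) {w : Node} (hw : IsDescendant root w)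
    {z : 𝒳} (hz : z ∈ P w.1 w.2) :
    best f - f z ≤ 4 * ν₁ * ρ ^ H + ∑ h ∈ Finset.range H, ∑ i ∈ nearIndices P f ν₁ ρ h,
      4 * ν₁ * ρ ^ h * ((if w = (h, i) then 1 else 0)
        + (if ¬ NearOptimalNode P f ν₁ ρ (child₁ (h, i)) ∧ IsDescendant (child₁ (h, i)) w
            then 1 else 0)
        + (if ¬ NearOptimalNode P f ν₁ ρ (child₂ (h, i)) ∧ IsDescendant (child₂ (h, i)) w
            then 1 else 0)) := by
  set F : ℕ → ℕ → ℝ := fun h i => 4 * ν₁ * ρ ^ h * ((if w = (h, i) then 1 else 0)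
        + (if ¬ NearOptimalNode P f ν₁ ρ (child₁ (h, i)) ∧ IsDescendant (child₁ (h, i)) w
            then 1 else 0)
        + (if ¬ NearOptimalNode P f ν₁ ρ (child₂ (h, i)) ∧ IsDescendant (child₂ (h, i)) w
            then 1 else 0)) with hF
  have hF0 : ∀ h i, 0 ≤ F h i := by
    intro h i
    simp only [hF]
    refine mul_nonneg (by positivity) (add_nonneg (add_nonneg ?_ ?_) ?_) <;> split_ifs <;> norm_num
  have hpow : ∀ h, 0 ≤ 4 * ν₁ * ρ ^ h := fun h => by positivity
  have hsingle : ∀ v : Node, IsDescendant root v → NearOptimalNode P f ν₁ ρ v → v.1 < H →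
      F v.1 v.2 ≤ ∑ h ∈ Finset.range H, ∑ i ∈ nearIndices P f ν₁ ρ h, F h i := by
    intro v hv hnear hlt
    have hmem : v.2 ∈ nearIndices P f ν₁ ρ v.1 := by
      rw [mem_nearIndices]
      exact ⟨⟨hv.one_le (by simp [root]), hv.le_two_pow⟩, hnear⟩
    calc F v.1 v.2 ≤ ∑ i ∈ nearIndices P f ν₁ ρ v.1, F v.1 i :=
          Finset.single_le_sum (fun i _ => hF0 v.1 i) hmem
      _ ≤ _ := Finset.single_le_sum
          (f := fun h => ∑ i ∈ nearIndices P f ν₁ ρ h, F h i)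
          (fun h _ => Finset.sum_nonneg fun i _ => hF0 h i) (Finset.mem_range.2 hlt)
  have hsum0 : 0 ≤ ∑ h ∈ Finset.range H, ∑ i ∈ nearIndices P f ν₁ ρ h, F h i :=
    Finset.sum_nonneg fun h _ => Finset.sum_nonneg fun i _ => hF0 h i
  have hin : ∀ v, IsDescendant root v → IsDescendant v w → z ∈ P v.1 v.2 :=
    fun v hv hvw => hP.subset hv hvw hz
  rcases node_trichotomy (NearOptimalNode P f ν₁ ρ) hroot H hw with
    ⟨v, c, h1, h2, h3, h4, h5, h6⟩ | ⟨v, h1, h2, h3, h4⟩ | ⟨h1, h2⟩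
  · have hvc : IsDescendant v c := by
      rcases h4 with rfl | rfl
      · exact isDescendant_child₁ v
      · exact isDescendant_child₂ v
    have hg := h2 z (hin v h1 (hvc.trans h6))
    have hone : 4 * ν₁ * ρ ^ v.1 ≤ F v.1 v.2 := by
      simp only [hF]
      refine le_mul_of_one_le_right (hpow _) ?_
      rcases h4 with rfl | rfl
      · rw [if_pos (⟨h5, h6⟩ : ¬ NearOptimalNode P f ν₁ ρ (child₁ (v.1, v.2)) ∧ _)]
        split_ifs <;> norm_num
      · rw [if_pos (⟨h5, h6⟩ : ¬ NearOptimalNode P f ν₁ ρ (child₂ (v.1, v.2)) ∧ _)]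
        split_ifs <;> norm_num
    linarith [hsingle v h1 h2 h3, hpow H]
  · have hg := h2 z (hin v h1 h4)
    rw [h3] at hg
    linarith
  · have hg := h1 z hz
    have hone : 4 * ν₁ * ρ ^ w.1 ≤ F w.1 w.2 := by
      simp only [hF]
      refine le_mul_of_one_le_right (hpow _) ?_
      rw [if_pos trivial]
      split_ifs <;> norm_num
    linarith [hsingle w hw h1 h2, hpow H]

/-- Summed over the rounds, the first indicator contributes at most `1`, since nodes above the
truncation depth are played once; the other two become visit counts. -/
lemma sum_gap_le (hP : IsTreeOfCoverings P) (hν₁ : 0 < ν₁) (hρ₀ : 0 < ρ)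
    (hroot : NearOptimalNode P f ν₁ ρ root) (hHOO : IsTruncatedHOO ν₁ ρ n₀ N y)
    (hx : ∀ t, 1 ≤ t → t ≤ n₀ → x t ∈ P (N t).1 (N t).2) {H : ℕ} (hH : H ≤ truncDepth ν₁ ρ n₀) :
    ∑ t ∈ Finset.Icc 1 n₀, (best f - f (x t)) ≤ 4 * ν₁ * ρ ^ H * n₀ +
      ∑ h ∈ Finset.range H, ∑ i ∈ nearIndices P f ν₁ ρ h, 4 * ν₁ * ρ ^ h *
        (1 + suboptimalCount P f ν₁ ρ N n₀ (child₁ (h, i))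
          + suboptimalCount P f ν₁ ρ N n₀ (child₂ (h, i))) := by
  classical
  have hdesc : ∀ t ∈ Finset.Icc 1 n₀, IsDescendant root (N t) := fun t ht => by
    have ht := Finset.mem_Icc.1 ht
    exact isDescendant_of_greedy (hHOO t ht.1 ht.2).1
  have hsub : ∀ c : Node, ∑ t ∈ Finset.Icc 1 n₀,
      (if ¬ NearOptimalNode P f ν₁ ρ c ∧ IsDescendant c (N t) then (1 : ℝ) else 0)
        = suboptimalCount P f ν₁ ρ N n₀ c := by
    intro c
    unfold suboptimalCount count visits
    by_cases hc : NearOptimalNode P f ν₁ ρ c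
    · simp [hc]
    · simp only [hc, not_false_iff, true_and, if_false, Finset.sum_boole]
  refine (Finset.sum_le_sum fun t ht => gap_le_sum hP hν₁ hρ₀ hroot H (hdesc t ht)
    (hx t (Finset.mem_Icc.1 ht).1 (Finset.mem_Icc.1 ht).2)).trans ?_
  rw [Finset.sum_add_distrib]
  refine add_le_add ?_ ?_
  · simp [mul_comm]
  · rw [Finset.sum_comm]
    refine Finset.sum_le_sum fun h hh => ?_
    rw [Finset.sum_comm]
    refine Finset.sum_le_sum fun i hi => ?_
    rw [← Finset.mul_sum, Finset.sum_add_distrib, Finset.sum_add_distrib, hsub, hsub]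
    gcongr
    rw [Finset.sum_boole]
    have hlt : ((h, i) : Node).1 < truncDepth ν₁ ρ n₀ := by
      have := Finset.mem_range.1 hh
      simp only; omega
    exact_mod_cast card_plays_le_one hHOO hlt

end Decomposition

/-- Every pair `(h, i)` with `1 ≤ i ≤ 2 ^ h` is a node of the tree. -/
lemma isDescendant_root {h i : ℕ} (h1 : 1 ≤ i) (h2 : i ≤ 2 ^ h) : IsDescendant root (h, i) := by
  induction h generalizing i with
  | zero =>
    obtain rfl : i = 1 := by simp at h2; omega
    exact .refl _
  | succ h ih =>
    have h2' : i ≤ 2 * 2 ^ h := by rwa [pow_succ, mul_comm] at h2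
    refine (ih (i := (i + 1) / 2) (by omega) (by omega)).tail ?_
    rcases Nat.even_or_odd' i with ⟨k, rfl | rfl⟩
    · right
      simp only [child₂, Prod.mk.injEq, true_and]; omega
    · left
      simp only [child₁, Prod.mk.injEq, true_and]; omega

/-! ### Counting near-optimal nodes by packings -/

section Packing

variable {𝒳 : Type*} {P : ℕ → ℕ → Set 𝒳} {ν₁ ρ ν₂ : ℝ} {ℓ : 𝒳 → 𝒳 → ℝ} {f : 𝒳 → ℝ}

/-- The balls of the first assumption are disjoint and inherit near-optimality from their regions.
The constant `c = 4ν₁ / ν₂` is the ratio of the gap `4ν₁ρ^h` to the radius `ν₂ρ^h`. -/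
lemma card_nearIndices_le_packingNumber (hℓ : IsDissimilarity ℓ) (hA1 : Shrinking P ℓ ν₁ ρ ν₂)
    (hρ₀ : 0 < ρ) (hν₂ : 0 < ν₂) (h : ℕ) :
    ((nearIndices P f ν₁ ρ h).card : ℕ∞) ≤
      packingNumber (nearOptimal f (4 * ν₁ / ν₂ * (ν₂ * ρ ^ h))) ℓ (ν₂ * ρ ^ h) := by
  classical
  obtain ⟨c, hc1, hc2⟩ := hA1.exists_balls h
  have hmem : ∀ i ∈ nearIndices P f ν₁ ρ h,
      (1 ≤ i ∧ i ≤ 2 ^ h) ∧ NearOptimalNode P f ν₁ ρ (h, i) := fun i hi => mem_nearIndices.1 hi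
  have hself : ∀ x, x ∈ ball ℓ x (ν₂ * ρ ^ h) := fun x => by
    change ℓ x x < _
    rw [hℓ.self]; positivity
  have hdisj : ∀ i ∈ nearIndices P f ν₁ ρ h, ∀ j ∈ nearIndices P f ν₁ ρ h, i ≠ j →
      Disjoint (ball ℓ (c i) (ν₂ * ρ ^ h)) (ball ℓ (c j) (ν₂ * ρ ^ h)) := by
    intro i hi j hj hij
    rcases lt_or_gt_of_ne hij with hlt | hlt
    · exact hc2 i j (hmem i hi).1.1 hlt (hmem j hj).1.2
    · exact (hc2 j i (hmem j hj).1.1 hlt (hmem i hi).1.2).symm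
  have hinj : Set.InjOn c (nearIndices P f ν₁ ρ h) := by
    intro i hi j hj hij
    by_contra hne
    have := hdisj i hi j hj hne
    rw [hij] at this
    exact (Set.disjoint_left.1 this (hself _) (hself _))
  rw [← Finset.card_image_of_injOn hinj]
  refine le_iSup₂ (f := fun (s : Finset 𝒳) (_ : (∀ x ∈ s, ball ℓ x (ν₂ * ρ ^ h) ⊆
    nearOptimal f (4 * ν₁ / ν₂ * (ν₂ * ρ ^ h))) ∧
    (s : Set 𝒳).PairwiseDisjoint fun x => ball ℓ x (ν₂ * ρ ^ h)) => (s.card : ℕ∞)) _ ⟨?_, ?_⟩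
  · intro x hx
    obtain ⟨i, hi, rfl⟩ := Finset.mem_image.1 hx
    obtain ⟨⟨h1, h2⟩, hnear⟩ := hmem i hi
    intro z hz
    have := hnear z ((hc1 i h1 h2).2 hz)
    have e : 4 * ν₁ / ν₂ * (ν₂ * ρ ^ h) = 4 * ν₁ * ρ ^ h := by field_simp
    change best f - _ ≤ f z
    rw [e]; linarith
  · intro a ha b hb hab
    obtain ⟨i, hi, rfl⟩ := Finset.mem_image.1 (Finset.mem_coe.1 ha)
    obtain ⟨j, hj, rfl⟩ := Finset.mem_image.1 (Finset.mem_coe.1 hb)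
    exact hdisj i hi j hj fun e => hab (by rw [e])

lemma card_nearIndices_le (h : ℕ) : (nearIndices P f ν₁ ρ h).card ≤ 2 ^ h := by
  have hsub : nearIndices P f ν₁ ρ h ⊆ Finset.Icc 1 (2 ^ h) := fun i hi =>
    Finset.mem_Icc.2 (mem_nearIndices.1 hi).1
  simpa using Finset.card_le_card hsub

/-- The number of near-optimal nodes grows at most at the rate given by the dimension. -/
lemma exists_card_nearIndices_le (hℓ : IsDissimilarity ℓ) (hA1 : Shrinking P ℓ ν₁ ρ ν₂)
    (hρ₀ : 0 < ρ) (hρ₁ : ρ < 1) (hν₂ : 0 < ν₂) {d' : ℝ}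
    (hd : nearOptDim f ℓ (4 * ν₁ / ν₂) < (d' : EReal)) :
    0 < d' ∧ ∃ C : ℝ, 0 < C ∧
      ∀ h, ((nearIndices P f ν₁ ρ h).card : ℝ) ≤ C * (ρ ^ (-d')) ^ h := by
  rw [nearOptDim, max_lt_iff] at hd
  have hd0 : 0 < d' := by exact_mod_cast hd.1
  refine ⟨hd0, ?_⟩
  have hone : 1 ≤ ρ ^ (-d') := Real.one_le_rpow_of_pos_of_le_one_of_nonpos hρ₀ hρ₁.le (by linarith)
  have hev := eventually_lt_of_limsup_lt hd.2
  have hlim : Tendsto (fun h : ℕ => ν₂ * ρ ^ h) atTop (𝓝[>] 0) := by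
    rw [tendsto_nhdsWithin_iff]
    refine ⟨?_, Eventually.of_forall fun h => by simp only [Set.mem_Ioi]; positivity⟩
    simpa using (tendsto_pow_atTop_nhds_zero_of_lt_one hρ₀.le hρ₁).const_mul ν₂
  have hlt1 : ∀ᶠ h : ℕ in atTop, ν₂ * ρ ^ h < 1 :=
    (hlim.mono_right nhdsWithin_le_nhds).eventually (gt_mem_nhds zero_lt_one)
  obtain ⟨h₀, hh₀⟩ := eventually_atTop.1 ((hlim.eventually hev).and hlt1)
  -- The dimension controls only depths from `h₀` on; the finitely many levels before are bounded by
  -- `2 ^ h₀`.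
  refine ⟨max (ν₂ ^ (-d')) (2 ^ h₀), lt_max_of_lt_right (by positivity), fun h => ?_⟩
  rcases Nat.lt_or_ge h h₀ with hlt | hge
  · calc ((nearIndices P f ν₁ ρ h).card : ℝ) ≤ 2 ^ h := by exact_mod_cast card_nearIndices_le h
      _ ≤ 2 ^ h₀ := pow_le_pow_right₀ (by norm_num) hlt.le
      _ ≤ max (ν₂ ^ (-d')) (2 ^ h₀) := le_max_right _ _
      _ ≤ _ := le_mul_of_one_le_right (by positivity) (one_le_pow₀ hone)
  · obtain ⟨h1, h2⟩ := hh₀ h hge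
    set ε := ν₂ * ρ ^ h with hε
    have hε0 : 0 < ε := by positivity
    have hlog : 0 < Real.log ε⁻¹ := Real.log_pos ((one_lt_inv₀ hε0).2 h2)
    rw [EReal.div_lt_iff (by exact_mod_cast hlog) (EReal.coe_ne_top _)] at h1
    set k := (nearIndices P f ν₁ ρ h).card with hk
    rcases Nat.eq_zero_or_pos k with h0 | h0
    · rw [h0]; simp only [Nat.cast_zero]; positivity
    have hkr : (0 : ℝ) < k := by exact_mod_cast h0
    have hpack : ENNReal.log (k : ENNReal) ≤ (d' : EReal) * (Real.log ε⁻¹ : EReal) := by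
      refine le_trans (ENNReal.log_monotone ?_) h1.le
      have := card_nearIndices_le_packingNumber (f := f) hℓ hA1 hρ₀ hν₂ h
      exact_mod_cast (ENat.toENNReal_le.2 this)
    have hkl : ENNReal.log (k : ENNReal) = ((Real.log k : ℝ) : EReal) := by
      rw [ENNReal.log_pos_real (by simpa using h0.ne') (by simp)]
      simp
    rw [hkl, ← EReal.coe_mul, EReal.coe_le_coe_iff] at hpack
    have hkle : (k : ℝ) ≤ ε ^ (-d') := by
      rw [Real.log_le_iff_le_exp hkr] at hpack
      rw [Real.rpow_def_of_pos hε0]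
      refine hpack.trans (le_of_eq ?_)
      rw [Real.log_inv]; ring_nf
    calc (k : ℝ) ≤ ε ^ (-d') := hkle
      _ = ν₂ ^ (-d') * (ρ ^ (-d')) ^ h := by
          rw [hε, Real.mul_rpow hν₂.le (by positivity), Real.rpow_pow_comm hρ₀.le]
      _ ≤ _ := by gcongr; exact le_max_left _ _

end Packing

/-! ### The expected regret -/

section Expectation

lemma pseudoRegret_eq_sum {Ω 𝒳 : Type*} (f : 𝒳 → ℝ) (X : ℕ → Ω → 𝒳) (n : ℕ) (ω : Ω) :
    pseudoRegret f X n ω = ∑ t ∈ Finset.Icc 1 n, (best f - f (X t ω)) := by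
  simp [pseudoRegret, Finset.sum_sub_distrib]

variable {Ω 𝒳 : Type*} [MeasurableSpace 𝒳] {M : BanditEnv 𝒳}
  {P : ℕ → ℕ → Set 𝒳} {ν₁ ρ ν₂ : ℝ} {ℓ : 𝒳 → 𝒳 → ℝ} {n₀ : ℕ}
  {N : ℕ → Ω → Node} {X : ℕ → Ω → 𝒳} {Y : ℕ → Ω → ℝ}

lemma BanditEnv.mean_le_best (M : BanditEnv 𝒳) (x : 𝒳) : M.mean x ≤ best M.mean :=
  le_ciSup (f := M.mean) ⟨1, by rintro _ ⟨x, rfl⟩; exact (M.mean_mem_Icc x).2⟩ x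

lemma BanditEnv.best_le_one [Nonempty 𝒳] (M : BanditEnv 𝒳) : best M.mean ≤ 1 :=
  ciSup_le fun x => (M.mean_mem_Icc x).2

lemma nearOptimalNode_root [Nonempty 𝒳] (hP : IsTreeOfCoverings P)
    (hℓ : IsDissimilarity ℓ) (hA1 : Shrinking P ℓ ν₁ ρ ν₂) (hA2 : WeaklyLipschitz ℓ M.mean)
    (hν₁ : 0 < ν₁) : NearOptimalNode P M.mean ν₁ ρ root := by
  intro x hx
  have := gap_le_of_optimalNode hℓ hA1 hA2 (.refl _) (optimalNode_root hP) hx M.mean_le_best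
  simp only [root, pow_zero, mul_one] at this ⊢
  linarith

/-- The visits to a suboptimal node, up to an event on which some confidence bound fails. -/
lemma suboptimalCount_le_of_notMem {p : ℕ → Node} (hP : IsTreeOfCoverings P)
    (hℓ : IsDissimilarity ℓ) (hA1 : Shrinking P ℓ ν₁ ρ ν₂) (hA2 : WeaklyLipschitz ℓ M.mean)
    (hν₁ : 0 < ν₁) (hρ₀ : 0 < ρ) (hp0 : p 0 = root)
    (hp : ∀ s, p (s + 1) = child₁ (p s) ∨ p (s + 1) = child₂ (p s))
    (hopt : ∀ s, IsDescendant root (p s) ∧ OptimalNode P M.mean (p s)) {ω : Ω}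
    (hHOO : IsTruncatedHOO ν₁ ρ n₀ (fun t => N t ω) (fun t => Y t ω))
    (hX : ∀ t, 1 ≤ t → t ≤ n₀ → X t ω ∈ P (N t ω).1 (N t ω).2)
    {v : Node} (hv : IsDescendant root v) (hvdev : ω ∉ deviationEvent M.mean n₀ N X Y v)
    (hpdev : ∀ s ≤ truncDepth ν₁ ρ n₀, ω ∉ deviationEvent M.mean n₀ N X Y (p s)) :
    suboptimalCount P M.mean ν₁ ρ (fun t => N t ω) n₀ v
      ≤ 8 * Real.log n₀ / (ν₁ * ρ ^ v.1) ^ 2 + 1 := by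
  have hL : 0 ≤ Real.log n₀ := Real.log_natCast_nonneg _
  have hu : 0 ≤ 8 * Real.log n₀ / (ν₁ * ρ ^ v.1) ^ 2 := by positivity
  unfold suboptimalCount
  split_ifs with hnear
  · positivity
  have hmem : ∀ w : Node, IsDescendant root w → ∀ n ≤ n₀, ∀ t ∈ visits (fun t => N t ω) w n,
      X t ω ∈ P w.1 w.2 := by
    intro w hw n hn t ht
    obtain ⟨⟨h1, h2⟩, h3⟩ := mem_visits.1 ht
    exact hP.subset hw h3 (hX t h1 (h2.trans hn))
  have hdev : ∀ w : Node, ω ∉ deviationEvent M.mean n₀ N X Y w → ∀ n ≤ n₀,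
      0 < count (fun t => N t ω) w n →
      |∑ t ∈ visits (fun t => N t ω) w n, (Y t ω - M.mean (X t ω))|
        < Real.sqrt (2 * Real.log n₀ / count (fun t => N t ω) w n)
          * count (fun t => N t ω) w n := by
    intro w hw n hn hpos
    by_contra! hle
    exact hw ⟨n, hn, hpos, hle⟩
  refine count_le_of_confidence (b := best M.mean) hu hHOO hp0 hp ?_ hv ?_ le_rfl
  · intro n hn s hs
    refine best_le_UValue (f := M.mean) (x := fun t => X t ω) (hdev _ (hpdev s hs) n hn)
      fun t ht => ?_
    exact gap_le_of_optimalNode hℓ hA1 hA2 (hopt s).1 (hopt s).2 (hmem _ (hopt s).1 n hn t ht)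
      M.mean_le_best
  · intro n hn hpos hcount
    refine UValue_lt_best (f := M.mean) (x := fun t => X t ω) hpos (by positivity) hcount
      (hdev _ hvdev n hn hpos) fun t ht => ?_
    exact (gap_gt_of_not_nearOptimalNode hℓ hA1 hA2 hv hnear (hmem _ hv n hn t ht)).le

variable [MeasurableSpace Ω] {μ : Measure Ω} [IsProbabilityMeasure μ]

lemma IsTruncatedHOORun.integrable_pseudoRegret
    (h : IsTruncatedHOORun M P ν₁ ρ n₀ μ N X Y) : Integrable (pseudoRegret M.mean X n₀) μ := by
  refine (integrable_const _).sub (integrable_finsetSum _ fun t ht => ?_)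
  have ht := Finset.mem_Icc.1 ht
  refine Integrable.of_bound
    (M.measurable_mean.comp (h.measurable_arm t ht.1 ht.2)).aestronglyMeasurable 1 ?_
  refine ae_of_all _ fun ω => ?_
  have hω := M.mean_mem_Icc (X t ω)
  change ‖M.mean (X t ω)‖ ≤ 1
  rw [Real.norm_eq_abs, abs_le]; exact ⟨by linarith [hω.1], hω.2⟩

/-- A visit count is at most `u h` if the bounds of the node and of the `D + 1` path nodes hold, and
at most `n₀` otherwise. The failure has probability at most `(D + 2) * 2 / n₀²`, which explains the
last summand. -/
theorem IsTruncatedHOORun.integral_pseudoRegret_le [Nonempty 𝒳] (hP : IsTreeOfCoverings P)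
    (hℓ : IsDissimilarity ℓ) (hA1 : Shrinking P ℓ ν₁ ρ ν₂) (hA2 : WeaklyLipschitz ℓ M.mean)
    (hν₁ : 0 < ν₁) (hρ₀ : 0 < ρ) (h : IsTruncatedHOORun M P ν₁ ρ n₀ μ N X Y) (hn₀ : 1 ≤ n₀)
    {H : ℕ} (hH : H ≤ truncDepth ν₁ ρ n₀) :
    ∫ ω, pseudoRegret M.mean X n₀ ω ∂μ ≤ 4 * ν₁ * ρ ^ H * n₀ +
      ∑ h ∈ Finset.range H, (nearIndices P M.mean ν₁ ρ h).card * (4 * ν₁ * ρ ^ h *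
        (1 + 2 * (8 * Real.log n₀ / (ν₁ * ρ ^ (h + 1)) ^ 2 + 1
          + (truncDepth ν₁ ρ n₀ + 2) * (2 / n₀)))) := by
  obtain ⟨p, hp0, hp, hopt⟩ := exists_optimal_path hP M.mean
  set D := truncDepth ν₁ ρ n₀ with hD
  have hn : (0 : ℝ) < n₀ := by exact_mod_cast hn₀
  have hL : 0 ≤ Real.log n₀ := Real.log_natCast_nonneg _
  -- Measurable hulls have the same measure and make the indicators integrable at once.
  let E : Node → Set Ω := fun v => toMeasurable μ (deviationEvent M.mean n₀ N X Y v)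
  have hEm : ∀ v, MeasurableSet (E v) := fun v => measurableSet_toMeasurable _ _
  have hEμ : ∀ v, μ.real (E v) ≤ 2 / (n₀ : ℝ) ^ 2 := fun v => by
    have := h.measureReal_deviationEvent_le hn₀ v
    rwa [Measure.real, measure_toMeasurable]
  have hEI : ∀ v, Integrable ((E v).indicator (1 : Ω → ℝ)) μ := fun v =>
    (integrable_const (1 : ℝ)).indicator (hEm v)
  let β : Node → Ω → ℝ := fun c ω =>
    (E c).indicator 1 ω + ∑ s ∈ Finset.range (D + 1), (E (p s)).indicator 1 ω
  have hβI : ∀ c, Integrable (β c) μ := fun c =>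
    (hEI c).add (integrable_finsetSum _ fun s _ => hEI _)
  have hβint : ∀ c, ∫ ω, β c ω ∂μ ≤ (D + 2) * (2 / (n₀ : ℝ) ^ 2) := by
    intro c
    change ∫ ω, ((E c).indicator 1 ω + ∑ s ∈ Finset.range (D + 1), (E (p s)).indicator 1 ω) ∂μ ≤ _
    rw [integral_add (hEI c) (integrable_finsetSum _ fun s _ => hEI _),
      integral_finsetSum _ fun s _ => hEI _, integral_indicator_one (hEm c)]
    have : ∑ s ∈ Finset.range (D + 1), ∫ ω, (E (p s)).indicator (1 : Ω → ℝ) ω ∂μ ≤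
        ∑ s ∈ Finset.range (D + 1), 2 / (n₀ : ℝ) ^ 2 := by
      refine Finset.sum_le_sum fun s _ => ?_
      rw [integral_indicator_one (hEm _)]; exact hEμ _
    rw [Finset.sum_const, Finset.card_range, nsmul_eq_mul] at this
    push_cast at this
    linarith [hEμ c]
  have hind0 : ∀ v ω, 0 ≤ (E v).indicator (1 : Ω → ℝ) ω := fun v ω =>
    Set.indicator_nonneg (fun _ _ => zero_le_one) _
  have hβ0 : ∀ c ω, 0 ≤ β c ω := fun c ω =>
    add_nonneg (hind0 _ _) (Finset.sum_nonneg fun s _ => hind0 _ _)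
  have hβ1 : ∀ c ω, (ω ∈ E c ∨ ∃ s ≤ D, ω ∈ E (p s)) → 1 ≤ β c ω := by
    rintro c ω (hc | ⟨s, hs, hc⟩)
    · have : (E c).indicator (1 : Ω → ℝ) ω = 1 := by simp [hc]
      have h2 : 0 ≤ ∑ s ∈ Finset.range (D + 1), (E (p s)).indicator (1 : Ω → ℝ) ω :=
        Finset.sum_nonneg fun s _ => hind0 _ _
      change 1 ≤ (E c).indicator 1 ω + _
      linarith
    · have : (E (p s)).indicator (1 : Ω → ℝ) ω = 1 := by simp [hc]
      have h2 := Finset.single_le_sum (f := fun s => (E (p s)).indicator (1 : Ω → ℝ) ω)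
        (fun s _ => hind0 (p s) ω) (Finset.mem_range.2 (by omega : s < D + 1))
      change 1 ≤ (E c).indicator 1 ω + _
      simp only [this] at h2
      linarith [hind0 c ω]
  let u : ℕ → ℝ := fun h => 8 * Real.log n₀ / (ν₁ * ρ ^ (h + 1)) ^ 2 + 1
  have hu0 : ∀ h, 0 ≤ u h := fun h => by
    have : 0 ≤ 8 * Real.log n₀ / (ν₁ * ρ ^ (h + 1)) ^ 2 := by positivity
    change 0 ≤ _ + (1 : ℝ)
    linarith
  have hcount : ∀ ω, IsTruncatedHOO ν₁ ρ n₀ (fun t => N t ω) (fun t => Y t ω) →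
      (∀ t, 1 ≤ t → t ≤ n₀ → X t ω ∈ P (N t ω).1 (N t ω).2) →
      ∀ h c, c.1 = h + 1 → IsDescendant root c →
      suboptimalCount P M.mean ν₁ ρ (fun t => N t ω) n₀ c ≤ u h + n₀ * β c ω := by
    intro ω hHOO hX h c hc hroot
    by_cases hbad : ω ∈ E c ∨ ∃ s ≤ D, ω ∈ E (p s)
    · have h1 : suboptimalCount P M.mean ν₁ ρ (fun t => N t ω) n₀ c ≤ n₀ := by
        unfold suboptimalCount
        split_ifs
        · exact hn.le
        · exact_mod_cast count_le _ _ _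
      have h2 := mul_le_mul_of_nonneg_left (hβ1 c ω hbad) hn.le
      linarith [hu0 h]
    · push Not at hbad
      have h1 := suboptimalCount_le_of_notMem hP hℓ hA1 hA2 hν₁ hρ₀ hp0 hp
        (fun s => (hopt s).2) hHOO hX hroot
        (fun hm => hbad.1 (subset_toMeasurable _ _ hm))
        (fun s hs hm => hbad.2 s hs (subset_toMeasurable _ _ hm))
      rw [hc] at h1
      have h2 := mul_nonneg hn.le (hβ0 c ω)
      linarith
  let G : Ω → ℝ := fun ω => 4 * ν₁ * ρ ^ H * n₀ +
      ∑ h ∈ Finset.range H, ∑ i ∈ nearIndices P M.mean ν₁ ρ h, 4 * ν₁ * ρ ^ h *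
        (1 + 2 * u h + n₀ * (β (child₁ (h, i)) ω + β (child₂ (h, i)) ω))
  have hββ : ∀ h i, Integrable (fun ω => β (child₁ (h, i)) ω + β (child₂ (h, i)) ω) μ :=
    fun h i => (hβI _).add (hβI _)
  have hterm : ∀ h i, Integrable (fun ω => 4 * ν₁ * ρ ^ h *
        (1 + 2 * u h + n₀ * (β (child₁ (h, i)) ω + β (child₂ (h, i)) ω))) μ := fun h i =>
    ((integrable_const _).add ((hββ h i).const_mul _)).const_mul _
  have hGs : Integrable (fun ω => ∑ h ∈ Finset.range H, ∑ i ∈ nearIndices P M.mean ν₁ ρ h,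
      4 * ν₁ * ρ ^ h *
        (1 + 2 * u h + n₀ * (β (child₁ (h, i)) ω + β (child₂ (h, i)) ω))) μ :=
    integrable_finsetSum _ fun h _ => integrable_finsetSum _ fun i _ => hterm h i
  have hX : ∀ᵐ ω ∂μ, ∀ t, 1 ≤ t → t ≤ n₀ → X t ω ∈ P (N t ω).1 (N t ω).2 := by
    rw [ae_all_iff]; intro t
    by_cases ht : 1 ≤ t ∧ t ≤ n₀
    · filter_upwards [h.arm_mem t ht.1 ht.2] with ω hω _ _ using hω
    · exact ae_of_all _ fun ω h1 h2 => absurd ⟨h1, h2⟩ ht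
  have hle : ∀ᵐ ω ∂μ, pseudoRegret M.mean X n₀ ω ≤ G ω := by
    filter_upwards [h.node_selected, hX] with ω hHOO hXω
    rw [pseudoRegret_eq_sum]
    refine (sum_gap_le (x := fun t => X t ω) hP hν₁ hρ₀
      (nearOptimalNode_root hP hℓ hA1 hA2 hν₁) hHOO hXω hH).trans ?_
    refine add_le_add_right (Finset.sum_le_sum fun h _ => Finset.sum_le_sum fun i hi => ?_) _
    refine mul_le_mul_of_nonneg_left ?_ (by positivity)
    have hi' := (mem_nearIndices.1 hi).1
    have hroot : IsDescendant root (h, i) := isDescendant_root hi'.1 hi'.2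
    have h1 := hcount ω hHOO hXω h (child₁ (h, i)) rfl (hroot.trans (isDescendant_child₁ _))
    have h2 := hcount ω hHOO hXω h (child₂ (h, i)) rfl (hroot.trans (isDescendant_child₂ _))
    linarith
  calc ∫ ω, pseudoRegret M.mean X n₀ ω ∂μ ≤ ∫ ω, G ω ∂μ :=
        integral_mono_ae h.integrable_pseudoRegret ((integrable_const _).add hGs) hle
    _ = 4 * ν₁ * ρ ^ H * n₀ + ∑ h ∈ Finset.range H, ∑ i ∈ nearIndices P M.mean ν₁ ρ h,
        4 * ν₁ * ρ ^ h * (1 + 2 * u h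
          + n₀ * (∫ ω, β (child₁ (h, i)) ω ∂μ + ∫ ω, β (child₂ (h, i)) ω ∂μ)) := by
        rw [integral_add (integrable_const _) hGs, integral_const, probReal_univ, one_smul,
          integral_finsetSum _ fun h _ => integrable_finsetSum _ fun i _ => hterm h i]
        congr 1
        refine Finset.sum_congr rfl fun h _ => ?_
        rw [integral_finsetSum _ fun i _ => hterm h i]
        refine Finset.sum_congr rfl fun i _ => ?_
        rw [integral_const_mul, integral_add (integrable_const _)
          ((hββ h i).const_mul _), integral_const, probReal_univ, one_smul,
          integral_const_mul, integral_add (hβI _) (hβI _)]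
    _ ≤ _ := by
        refine add_le_add_right (Finset.sum_le_sum fun h _ => ?_) _
        rw [← nsmul_eq_mul, ← Finset.sum_const]
        refine Finset.sum_le_sum fun i _ => ?_
        refine mul_le_mul_of_nonneg_left ?_ (by positivity)
        have h1 := hβint (child₁ (h, i))
        have h2 := hβint (child₂ (h, i))
        have h3 : (n₀ : ℝ) * (∫ ω, β (child₁ (h, i)) ω ∂μ + ∫ ω, β (child₂ (h, i)) ω ∂μ) ≤
            n₀ * (2 * ((D + 2) * (2 / (n₀ : ℝ) ^ 2))) :=
          mul_le_mul_of_nonneg_left (by linarith) hn.le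
        have h4 : (n₀ : ℝ) * (2 * ((D + 2) * (2 / (n₀ : ℝ) ^ 2))) = 2 * ((D + 2) * (2 / n₀)) := by
          field_simp
        rw [h4] at h3
        change 1 + 2 * (8 * Real.log n₀ / (ν₁ * ρ ^ (h + 1)) ^ 2 + 1) + _ ≤ _
        linarith

end Expectation

/-! ### Tuning the depth -/

/-- The truncation depth is the least depth with `ν₁ρ^D ≤ 1 / √n₀`; rounding up goes in the right
direction. -/
lemma mul_pow_truncDepth_le {ν₁ ρ : ℝ} (hν₁ : 0 < ν₁) (hρ₀ : 0 < ρ) (hρ₁ : ρ < 1) {n₀ : ℕ}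
    (hn₀ : 1 ≤ n₀) : ν₁ * ρ ^ truncDepth ν₁ ρ n₀ * n₀ ≤ Real.sqrt n₀ := by
  have hn : (0 : ℝ) < n₀ := by exact_mod_cast hn₀
  have hlr : 0 < Real.log (1 / ρ) := Real.log_pos (by rw [lt_div_iff₀ hρ₀]; linarith)
  have h1 : (Real.log n₀ / 2 - Real.log (1 / ν₁)) / Real.log (1 / ρ) ≤ truncDepth ν₁ ρ n₀ :=
    Nat.le_ceil _
  rw [div_le_iff₀ hlr, one_div, one_div, Real.log_inv, Real.log_inv] at h1
  have hpos : 0 < ν₁ * ρ ^ truncDepth ν₁ ρ n₀ * n₀ := by positivity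
  rw [← Real.log_le_log_iff hpos (Real.sqrt_pos.2 hn), Real.log_sqrt hn.le,
    Real.log_mul (by positivity) hn.ne', Real.log_mul hν₁.ne' (by positivity), Real.log_pow]
  linarith

lemma sum_pow_le {q : ℝ} (hq : 1 < q) (H : ℕ) :
    ∑ h ∈ Finset.range H, q ^ h ≤ q ^ H / (q - 1) := by
  rw [geom_sum_eq hq.ne']
  exact div_le_div_of_nonneg_right (by linarith) (by linarith)

/-- The depth at which the two parts of the regret bound are balanced. -/
lemma exists_balanced_depth {ρ d : ℝ} (hρ₀ : 0 < ρ) (hρ₁ : ρ < 1) (hd : 0 < d) {n L : ℝ}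
    (hL : 0 < L) (hLn : L < n) : ∃ H : ℕ,
      n * ρ ^ H ≤ n ^ ((d + 1) / (d + 2)) * L ^ (1 / (d + 2)) / ρ ∧
      L * (ρ ^ (-d) / ρ) ^ H ≤ n ^ ((d + 1) / (d + 2)) * L ^ (1 / (d + 2)) := by
  have hn : 0 < n := hL.trans hLn
  have hd2 : 0 < d + 2 := by linarith
  -- The ideal value of `ρ ^ H`: it solves `n * x = L * x ^ (-(d + 1))`.
  set x : ℝ := (L / n) ^ (1 / (d + 2)) with hx
  have hx0 : 0 < x := by positivity
  have hx1 : x ≤ 1 := Real.rpow_le_one (by positivity) ((div_le_one hn).2 hLn.le) (by positivity)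
  have hnx : n * x = n ^ ((d + 1) / (d + 2)) * L ^ (1 / (d + 2)) := by
    rw [hx, Real.div_rpow hL.le hn.le]
    have : n = n ^ ((d + 1) / (d + 2)) * n ^ (1 / (d + 2)) := by
      rw [← Real.rpow_add hn, ← add_div, show d + 1 + 1 = d + 2 by ring, div_self hd2.ne',
        Real.rpow_one]
    have hne : n ^ (1 / (d + 2)) ≠ 0 := by positivity
    nth_rewrite 1 [this]
    field_simp
  have hLx : L * x ^ (-(d + 1)) = n * x := by
    have h1 : x ^ (d + 2) = L / n := by
      rw [hx, ← Real.rpow_mul (by positivity), one_div_mul_cancel hd2.ne', Real.rpow_one]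
    have h2 : L = n * (x * x ^ (d + 1)) := by
      rw [mul_comm x, ← Real.rpow_add_one hx0.ne', show d + 1 + 1 = d + 2 by ring, h1]
      field_simp
    rw [Real.rpow_neg hx0.le]
    have hne : x ^ (d + 1) ≠ 0 := by positivity
    nth_rewrite 1 [h2]
    field_simp
  -- Here `ρ ^ (H + 1) < x ≤ ρ ^ H`; rounding to an integer depth costs a factor `1 / ρ` in the
  -- first bound only.
  obtain ⟨H, h1, h2⟩ := exists_nat_pow_near_of_lt_one hx0 hx1 hρ₀ hρ₁
  refine ⟨H, ?_, ?_⟩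
  · rw [← hnx, mul_div_assoc]
    refine mul_le_mul_of_nonneg_left ?_ hn.le
    rw [le_div_iff₀ hρ₀, ← pow_succ]
    exact h1.le
  · rw [← hnx, ← hLx]
    refine mul_le_mul_of_nonneg_left ?_ hL.le
    have e : ρ ^ (-d) / ρ = ρ ^ (-(d + 1)) := by
      rw [show -(d + 1) = -d - 1 by ring, Real.rpow_sub_one hρ₀.ne']
    rw [e, Real.rpow_pow_comm hρ₀.le]
    exact Real.rpow_le_rpow_of_nonpos hx0 h2 (by linarith)

/-- The terms without `8 L` add up to at most `3 + 2 (2K + 2) = 7 + 4K`, and are absorbed through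
`ln 2 ≤ L` and `1 ≤ ρ^(-2h)`. -/
lemma depth_term_le {ν₁ ρ K L n D : ℝ} (hν₁ : 0 < ν₁) (hρ₀ : 0 < ρ) (hρ₁ : ρ < 1) (hK : 1 ≤ K)
    (hn : 2 ≤ n) (hLdef : L = Real.log n) (hD : D ≤ K * L) (h : ℕ) :
    1 + 2 * (8 * L / (ν₁ * ρ ^ (h + 1)) ^ 2 + 1 + (D + 2) * (2 / n)) ≤
      (16 / (ν₁ * ρ) ^ 2 + (7 + 4 * K) / Real.log 2) * L * (1 / ρ ^ 2) ^ h := by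
  have hl2 : 0 < Real.log 2 := Real.log_pos (by norm_num)
  have hL2 : Real.log 2 ≤ L := hLdef ▸ Real.log_le_log (by norm_num) hn
  have hLn : L ≤ n := hLdef ▸ (Real.log_le_self (by linarith))
  have hL0 : 0 < L := hl2.trans_le hL2
  have hn0 : 0 < n := by linarith
  have hp : 1 ≤ (1 / ρ ^ 2) ^ h := by
    refine one_le_pow₀ ?_
    rw [le_div_iff₀ (by positivity), one_mul]
    exact pow_le_one₀ hρ₀.le hρ₁.le
  have h1 : 8 * L / (ν₁ * ρ ^ (h + 1)) ^ 2 = 8 / (ν₁ * ρ) ^ 2 * L * (1 / ρ ^ 2) ^ h := by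
    rw [one_div, inv_pow, ← pow_mul]
    field_simp
    ring
  have h2 : (D + 2) * (2 / n) ≤ 2 * K + 2 := by
    rw [mul_div_assoc', div_le_iff₀ hn0]
    nlinarith
  have h3 : 7 + 4 * K ≤ (7 + 4 * K) / Real.log 2 * L * (1 / ρ ^ 2) ^ h := by
    have : 7 + 4 * K ≤ (7 + 4 * K) / Real.log 2 * L := by
      rw [div_mul_eq_mul_div, le_div_iff₀ hl2]
      exact mul_le_mul_of_nonneg_left hL2 (by linarith)
    exact this.trans (le_mul_of_one_le_right (by linarith) hp)
  rw [h1]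
  have : (16 / (ν₁ * ρ) ^ 2 + (7 + 4 * K) / Real.log 2) * L * (1 / ρ ^ 2) ^ h =
    2 * (8 / (ν₁ * ρ) ^ 2 * L * (1 / ρ ^ 2) ^ h)
      + (7 + 4 * K) / Real.log 2 * L * (1 / ρ ^ 2) ^ h := by ring
  rw [this]
  linarith

/-- The distribution-dependent regret bound of truncated HOO. -/
theorem exists_regret_bound {𝒳 : Type*} [MeasurableSpace 𝒳] (M : BanditEnv 𝒳)
    (P : ℕ → ℕ → Set 𝒳) (hP : IsTreeOfCoverings P) {ν₁ ρ : ℝ} (hν₁ : 0 < ν₁) (hρ₀ : 0 < ρ)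
    (hρ₁ : ρ < 1) {ℓ : 𝒳 → 𝒳 → ℝ} (hℓ : IsDissimilarity ℓ) {ν₂ : ℝ} (hν₂ : 0 < ν₂)
    (hA1 : Shrinking P ℓ ν₁ ρ ν₂) (hA2 : WeaklyLipschitz ℓ M.mean) {d' : ℝ}
    (hd' : nearOptDim M.mean ℓ (4 * ν₁ / ν₂) < (d' : EReal)) :
    ∃ γ : ℝ, ∀ n₀ : ℕ, 1 ≤ n₀ → ∀ (Ω : Type*) [MeasurableSpace Ω] (μ : Measure Ω)
      [IsProbabilityMeasure μ] (N : ℕ → Ω → Node) (X : ℕ → Ω → 𝒳) (Y : ℕ → Ω → ℝ),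
      IsTruncatedHOORun M P ν₁ ρ n₀ μ N X Y →
      ∫ ω, pseudoRegret M.mean X n₀ ω ∂μ ≤
        γ * (n₀ : ℝ) ^ ((d' + 1) / (d' + 2)) * (Real.log n₀) ^ (1 / (d' + 2))
          + 4 * Real.sqrt n₀ := by
  obtain ⟨hd0, C, hC0, hC⟩ := exists_card_nearIndices_le hℓ hA1 hρ₀ hρ₁ hν₂ hd'
  obtain ⟨K, hK1, hK⟩ := exists_truncDepth_le ν₁ hρ₀ hρ₁
  have hne : Nonempty 𝒳 := by
    obtain ⟨c, -⟩ := hA1.exists_balls 0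
    exact ⟨c 1⟩
  set q : ℝ := ρ ^ (-d') / ρ with hq
  have hone : 1 ≤ ρ ^ (-d') :=
    Real.one_le_rpow_of_pos_of_le_one_of_nonpos hρ₀ hρ₁.le (by linarith)
  have hq1 : 1 < q := by rw [hq, lt_div_iff₀ hρ₀]; linarith
  set A : ℝ := 16 / (ν₁ * ρ) ^ 2 + (7 + 4 * K) / Real.log 2 with hA
  have hA0 : 0 < A := by
    have : 0 < Real.log 2 := Real.log_pos (by norm_num)
    positivity
  set B : ℝ := C * (4 * ν₁) * A / (q - 1) with hB
  have hB0 : 0 < B := div_pos (by positivity) (by linarith)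
  refine ⟨4 * ν₁ / ρ + B, fun n₀ hn₀ Ω _ μ _ N X Y hrun => ?_⟩
  -- For `n₀ = 1` the logarithmic factor is `0`, and the regret is at most `1 ≤ 4√1`.
  rcases hn₀.eq_or_lt with rfl | hn2
  · have hle : ∀ ω, pseudoRegret M.mean X 1 ω ≤ 1 := fun ω => by
      have h1 := (M.mean_mem_Icc (X 1 ω)).1
      have h2 := M.best_le_one
      simp only [pseudoRegret, Finset.Icc_self, Finset.sum_singleton, Nat.cast_one, one_mul]
      linarith
    have h1 : ∫ ω, pseudoRegret M.mean X 1 ω ∂μ ≤ ∫ _, (1 : ℝ) ∂μ :=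
      integral_mono hrun.integrable_pseudoRegret (integrable_const _) hle
    have hexp : 1 / (d' + 2) ≠ 0 := by positivity
    simp only [integral_const, probReal_univ, one_smul] at h1
    simp only [Nat.cast_one, Real.log_one, Real.zero_rpow hexp, mul_zero, Real.sqrt_one]
    linarith
  have hn2' : (2 : ℝ) ≤ n₀ := by exact_mod_cast hn2
  have hn : (0 : ℝ) < n₀ := by linarith
  set L := Real.log n₀ with hL
  have hL0 : 0 < L := Real.log_pos (by linarith)
  have hLn : L < n₀ := (Real.log_lt_sub_one_of_pos hn (by linarith)).trans (by linarith)
  set Φ : ℝ := (n₀ : ℝ) ^ ((d' + 1) / (d' + 2)) * L ^ (1 / (d' + 2)) with hΦ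
  have hΦ0 : 0 ≤ Φ := by positivity
  have hmain : ∀ H ≤ truncDepth ν₁ ρ n₀, ∫ ω, pseudoRegret M.mean X n₀ ω ∂μ ≤
      4 * (ν₁ * ρ ^ H * n₀) + B * (L * q ^ H) := by
    intro H hH
    refine (hrun.integral_pseudoRegret_le hP hℓ hA1 hA2 hν₁ hρ₀ hn₀ hH).trans ?_
    refine add_le_add (le_of_eq (by ring)) ?_
    -- Number of nodes `ρ^(-d'h)`, gap `ρ^h` and visits `ρ^(-2h)` multiply to `q ^ h` with `q =
    -- ρ^(-(d'+1)) > 1`, so the geometric sum is of the order of `q ^ H`.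
    calc _ ≤ ∑ h ∈ Finset.range H, C * (4 * ν₁) * A * L * q ^ h := by
          refine Finset.sum_le_sum fun h _ => ?_
          calc _ ≤ C * (ρ ^ (-d')) ^ h * (4 * ν₁ * ρ ^ h * (A * L * (1 / ρ ^ 2) ^ h)) := by
                have h1 := depth_term_le hν₁ hρ₀ hρ₁ hK1 hn2' hL (hK n₀ hn2) h
                have h2 := hC h
                have h0 : 0 ≤ 8 * L / (ν₁ * ρ ^ (h + 1)) ^ 2 := by positivity
                have h3 : (0 : ℝ) ≤ (truncDepth ν₁ ρ n₀ + 2) * (2 / n₀) := by positivity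
                refine mul_le_mul h2 (mul_le_mul_of_nonneg_left h1 (by positivity)) ?_
                  (by positivity)
                exact mul_nonneg (by positivity) (by linarith)
            _ = _ := by
                rw [hq, div_pow, div_pow, one_pow, ← pow_mul]
                field_simp
                ring
      _ = C * (4 * ν₁) * A * L * ∑ h ∈ Finset.range H, q ^ h := by rw [Finset.mul_sum]
      _ ≤ C * (4 * ν₁) * A * L * (q ^ H / (q - 1)) :=
          mul_le_mul_of_nonneg_left (sum_pow_le hq1 H) (by positivity)
      _ = _ := by rw [hB]; ring
  obtain ⟨H, h1, h2⟩ := exists_balanced_depth hρ₀ hρ₁ hd0 hL0 hLn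
  have hgoal : (4 * ν₁ / ρ + B) * (n₀ : ℝ) ^ ((d' + 1) / (d' + 2)) * L ^ (1 / (d' + 2))
      = 4 * ν₁ / ρ * Φ + B * Φ := by rw [hΦ]; ring
  rw [hgoal]
  -- If the balanced depth is not available, the truncation depth replaces it: the sum only gets
  -- smaller, and the first term is at most `4√n₀`.
  rcases le_total H (truncDepth ν₁ ρ n₀) with hle | hle
  · refine (hmain H hle).trans ?_
    have h3 : 4 * (ν₁ * ρ ^ H * n₀) ≤ 4 * ν₁ / ρ * Φ := by
      have := mul_le_mul_of_nonneg_left h1 (by positivity : 0 ≤ 4 * ν₁)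
      calc _ = 4 * ν₁ * (n₀ * ρ ^ H) := by ring
        _ ≤ _ := this
        _ = _ := by ring
    have h4 := mul_le_mul_of_nonneg_left h2 hB0.le
    have h5 := Real.sqrt_nonneg (n₀ : ℝ)
    linarith
  · refine (hmain _ le_rfl).trans ?_
    have h3 := mul_pow_truncDepth_le hν₁ hρ₀ hρ₁ hn₀
    have h4 : L * q ^ truncDepth ν₁ ρ n₀ ≤ Φ :=
      (mul_le_mul_of_nonneg_left (pow_le_pow_right₀ hq1.le hle) hL0.le).trans h2
    have h5 := mul_le_mul_of_nonneg_left h4 hB0.le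
    have h6 : 0 ≤ 4 * ν₁ / ρ * Φ := by positivity
    linarith

end HOO

theorem theorem2 {𝒳 : Type*} [MeasurableSpace 𝒳] (M : HOO.BanditEnv 𝒳)
    (P : ℕ → ℕ → Set 𝒳) (hP : HOO.IsTreeOfCoverings P)
    (ν₁ ρ : ℝ) (hν₁ : 0 < ν₁) (hρ₀ : 0 < ρ) (hρ₁ : ρ < 1)
    (ℓ : 𝒳 → 𝒳 → ℝ) (hℓ : HOO.IsDissimilarity ℓ)
    (ν₂ : ℝ) (hν₂ : 0 < ν₂) (hA1 : HOO.Shrinking P ℓ ν₁ ρ ν₂)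
    (hA2 : HOO.WeaklyLipschitz ℓ M.mean) :
    -- the regret bound
    (∀ d' : ℝ, HOO.nearOptDim M.mean ℓ (4 * ν₁ / ν₂) < (d' : EReal) →
      ∃ γ : ℝ, ∀ n₀ : ℕ, 1 ≤ n₀ → 1 ≤ HOO.truncDepth ν₁ ρ n₀ →
        ∀ (Ω : Type*) [MeasurableSpace Ω] (μ : MeasureTheory.Measure Ω)
          [MeasureTheory.IsProbabilityMeasure μ]
          (N : ℕ → Ω → HOO.Node) (X : ℕ → Ω → 𝒳) (Y : ℕ → Ω → ℝ),
          HOO.IsTruncatedHOORun M P ν₁ ρ n₀ μ N X Y →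
          ∫ ω, HOO.pseudoRegret M.mean X n₀ ω ∂μ ≤
            γ * (n₀ : ℝ) ^ ((d' + 1) / (d' + 2)) * (Real.log n₀) ^ (1 / (d' + 2))
              + 4 * Real.sqrt n₀) ∧
    -- the program plays exactly as truncated HOO does
    (∀ n₀ : ℕ, 1 ≤ n₀ → 1 ≤ HOO.truncDepth ν₁ ρ n₀ → ∀ (N : ℕ → HOO.Node) (y : ℕ → ℝ),
      HOO.IsTruncatedHOO ν₁ ρ n₀ N y ↔
        ∃ tie : ℕ → HOO.Node → Bool,
          (HOO.program ν₁ ρ n₀ tie y).val.reverse = (List.range n₀).map fun t => N (t + 1)) ∧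
    -- and it runs in time `O(n₀ ln n₀)`
    (∃ C : ℝ, ∀ n₀ : ℕ, 2 ≤ n₀ → 1 ≤ HOO.truncDepth ν₁ ρ n₀ →
      ∀ (tie : ℕ → HOO.Node → Bool) (y : ℕ → ℝ),
        ((HOO.program ν₁ ρ n₀ tie y).time : ℝ) ≤ C * (n₀ * Real.log n₀)) := by
  refine ⟨fun d' hd' => ?_, fun n₀ _ hD N y => HOO.isTruncatedHOO_iff_program hD, ?_⟩
  · obtain ⟨γ, hγ⟩ := HOO.exists_regret_bound M P hP hν₁ hρ₀ hρ₁ hℓ hν₂ hA1 hA2 hd'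
    exact ⟨γ, fun n₀ hn₀ _ => hγ n₀ hn₀⟩
  · obtain ⟨C, hC⟩ := HOO.exists_program_time_le ν₁ hρ₀ hρ₁
    exact ⟨C, fun n₀ hn₀ _ => hC n₀ hn₀⟩
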